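/- Let $p$ be a prime and let $G$ be a second countable, $n$-dimensional $p$-adic Lie group, i.e. a Hausdorff $\mathbb{Q}_p$-analytic manifold of dimension $n$ that is a group with $\mathbb{Q}_p$-analytic multiplication; let $e$ be its identity and $\ell_h(g)=hg$. "Chart" means a chart of the maximal analytic atlas, with values in $\mathbb{Q}_p^n$. Let $\lambda$ be the Haar measure on $\mathbb{Q}_p^n$ with $\lambda(\mathbb{Z}_p^n)=1$ and $|\cdot|_p$ the $p$-adic absolute value. An $n$-form $\Omega$ on $G$ is left-invariant if $\ell_h^*\Omega=\Omega$ for all $h\in G$. If $\Omega$ is an analytic $n$-form, with $\Omega=\omega_\varphi\,dx_1\wedge\dots\wedge dx_n$ in the coordinates of a chart $(U,\varphi)$, its induced measure $\mu_\Omega$ is the Borel measure on $G$ with $$\mu_\Omega(E)=\int_{\varphi(E)}|\omega_\varphi(\varphi^{-1}(x))|_p\,d\lambda(x)$$ for every chart $(U,\varphi)$ and every Borel set $E\subseteq U$. Fix a chart $(U_0,\varphi_0)$ with $e\in U_0$. For a chart $(U,\varphi)$ and $g\in U$ put $\zeta_\varphi(g;x)=\varphi(g\,\varphi_0^{-1}(x))$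 for $x$ near $\varphi_0(e)$, and let $J_\varphi(g)=\det[D\zeta_\varphi(g;\varphi_0(e))]$ be the Jacobian determinant in $x$ at $x=\varphi_0(e)$. Fix a basis $X_1,\dots,X_n$ of $T_eG$, let $\widetilde X_1,\dots,\widetilde X_n$ be the left-invariant vector fields extending it, let $\omega_1,\dots,\omega_n$ be the dual $1$-forms, $\omega_i(\widetilde X_j)=\delta_{ij}$, and put $\Omega_{\mathrm{inv}}=\omega_1\wedge\dots\wedge\omega_n$. Then: 1. $\zeta_\varphi(g;\cdot)$ is differentiable at $\varphi_0(e)$ and $J_\varphi(g)\neq 0$ for every chart $(U,\varphi)$ and every $g\in U$. The local expressions $J_\varphi(g)^{-1}\,dx_1\wedge\dots\wedge dx_n$ do not depend on the chart $\varphi$ around $g$, and define an analytic $n$-form $\breve\Omega$ on $G$. 2. $\breve\Omega$ is left-invariant. 3. $\Omega_{\mathrm{inv}}$ is analytic, nowhere zero and left-invariant, and every left-invariant $n$-form on $G$ equals $c\,\Omega_{\mathrm{inv}}$ for some $c\in\mathbb{Q}_p$. 4. The measures $\mu_{\breve\Omega}$ and $\mu_{\Omega_{\mathrm{inv}}}$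 exist, and there is $c\in\mathbb{Q}_p$, $c\neq0$, with $\breve\Omega=c\,\Omega_{\mathrm{inv}}$ and $\mu_{\breve\Omega}=|c|_p\,\mu_{\Omega_{\mathrm{inv}}}$. 5. $\mu=\mu_{\breve\Omega}$ is a left Haar measure on $G$ and satisfies, for every chart $(U,\varphi)$ and every Borel set $E\subseteq G$, $$\mu(E\cap U)=\int_{\varphi(E\cap U)}\bigl|J_\varphi(\varphi^{-1}(y))\bigr|_p^{-1}\,d\lambda(y);$$ moreover, any Borel measure on $G$ that satisfies this formula on a family of charts covering $G$ equals $\mu_{\breve\Omega}$. 6. $\mu_{\Omega_{\mathrm{inv}}}$ is a left Haar measure on $G$, and every left Haar measure on $G$ equals $c\,\mu_{\Omega_{\mathrm{inv}}}$ for some real $c>0$. -/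

import Mathlib

open MeasureTheory Set
open scoped Manifold ContDiff ENNReal NNReal

noncomputable section

namespace PadicLie

section Measure

variable (p : ℕ) [Fact p.Prime]

instance instMeasurableSpacePadic : MeasurableSpace ℚ_[p] := borel ℚ_[p]

instance instBorelSpacePadic : BorelSpace ℚ_[p] := ⟨rfl⟩

/-- The ring of `p`-adic integers, as a compact neighbourhood of `0` in `ℚ_[p]`. -/
def integersCompact : TopologicalSpace.PositiveCompacts ℚ_[p] where
  carrier := Metric.closedBall 0 1
  isCompact' := isCompact_closedBall 0 1
  interior_nonempty' :=
    ⟨0, Metric.ball_subset_interior_closedBall (Metric.mem_ball_self one_pos)⟩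

/-- The Haar measure on `ℚ_[p]^n`: the `n`-fold product of the Haar measure on `ℚ_[p]` that gives
the `p`-adic integers mass `1`. -/
def haarPadic (n : ℕ) : Measure (Fin n → ℚ_[p]) :=
  Measure.pi fun _ => Measure.addHaarMeasure (integersCompact p)

end Measure

variable {p : ℕ} [Fact p.Prime] {n : ℕ}

section Forms

variable {M : Type*} [TopologicalSpace M] [ChartedSpace (Fin n → ℚ_[p]) M]
  {N : Type*} [TopologicalSpace N] [ChartedSpace (Fin n → ℚ_[p]) N]

variable (p n M) in
/-- The charts of the maximal `ℚ_[p]`-analytic atlas of the `n`-dimensional manifold `M`. -/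
abbrev charts : Set (OpenPartialHomeomorph M (Fin n → ℚ_[p])) :=
  IsManifold.maximalAtlas 𝓘(ℚ_[p], Fin n → ℚ_[p]) ω M

variable (p n M) in
/-- (Not necessarily analytic) differential forms of top degree `n` on the `n`-dimensional
manifold `M`: an alternating `n`-linear form on each tangent space. -/
abbrev TopForm : Type _ :=
  ∀ g : M, (TangentSpace 𝓘(ℚ_[p], Fin n → ℚ_[p]) g) [⋀^Fin n]→ₗ[ℚ_[p]] ℚ_[p]

/-- The wedge product `θ₁ ∧ … ∧ θₙ` of `n` linear forms, i.e.
`(v₁, …, vₙ) ↦ det (θᵢ vⱼ)`. -/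
def wedge {V : Type*} [AddCommGroup V] [Module ℚ_[p] V] (θ : Fin n → (V →ₗ[ℚ_[p]] ℚ_[p])) :
    V [⋀^Fin n]→ₗ[ℚ_[p]] ℚ_[p] :=
  (Pi.basisFun ℚ_[p] (Fin n)).det.compLinearMap (LinearMap.pi θ)

/-- The form `dx₁ ∧ … ∧ dxₙ` of the local coordinates of the chart `φ`, at the point `g` of its
domain. -/
def coordForm (φ : OpenPartialHomeomorph M (Fin n → ℚ_[p])) (g : M) :
    (TangentSpace 𝓘(ℚ_[p], Fin n → ℚ_[p]) g) [⋀^Fin n]→ₗ[ℚ_[p]] ℚ_[p] :=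
  wedge fun i => (LinearMap.proj i : (Fin n → ℚ_[p]) →ₗ[ℚ_[p]] ℚ_[p]) ∘ₗ
    (mfderiv 𝓘(ℚ_[p], Fin n → ℚ_[p]) 𝓘(ℚ_[p], Fin n → ℚ_[p]) φ g).toLinearMap

/-- The coefficient of `Ω` in the chart `φ`, as a function on the range of `φ`: its value at
`x = φ g` is the scalar `w` with `Ω g = w dx₁ ∧ … ∧ dxₙ`, i.e. the value of `Ω g` on the
coordinate vectors `∂/∂x₁, …, ∂/∂xₙ`. -/
def coeff (Ω : TopForm p n M) (φ : OpenPartialHomeomorph M (Fin n → ℚ_[p]))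
    (x : Fin n → ℚ_[p]) : ℚ_[p] :=
  Ω (φ.symm x) fun i =>
    mfderiv 𝓘(ℚ_[p], Fin n → ℚ_[p]) 𝓘(ℚ_[p], Fin n → ℚ_[p]) φ.symm x
      (Pi.single i 1 : Fin n → ℚ_[p])

/-- The form `Ω` is analytic: all its local coefficients are. -/
def IsAnalyticForm (Ω : TopForm p n M) : Prop :=
  ∀ φ ∈ charts p n M, AnalyticOnNhd ℚ_[p] (coeff Ω φ) φ.target

/-- The pullback `F^* Ω`. -/
def pullback (F : M → N) (Ω : TopForm p n N) : TopForm p n M := fun g =>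
  (Ω (F g)).compLinearMap
    (mfderiv 𝓘(ℚ_[p], Fin n → ℚ_[p]) 𝓘(ℚ_[p], Fin n → ℚ_[p]) F g).toLinearMap

variable [MeasurableSpace M]

/-- The measure `|w_φ| dλ` of the form `Ω` on the domain of the chart `φ`, where `w_φ` is the
coefficient of `Ω`, transported from the range of `φ` and extended by zero to `M`. -/
def chartMeasure (Ω : TopForm p n M) (φ : OpenPartialHomeomorph M (Fin n → ℚ_[p])) : Measure M :=
  (((haarPadic p n).restrict φ.target).withDensity fun x => ‖coeff Ω φ x‖ₑ).map φ.symm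

/-- The measure `μ_Ω` induced by the form `Ω`: the measures on the chart domains glued together,
i.e. the least measure on `M` that dominates all of them. -/
def inducedMeasure (Ω : TopForm p n M) : Measure M :=
  ⨆ φ ∈ charts p n M, chartMeasure Ω φ

/-- The defining formula of the measure induced by `Ω`:
`μ E = ∫_{φ(E)} |w_φ| dλ` for all charts `φ` and all Borel sets `E` in the domain of `φ`. -/
def HasFormDensity (Ω : TopForm p n M) (μ : Measure M) : Prop :=
  ∀ φ ∈ charts p n M, ∀ E : Set M, MeasurableSet E → E ⊆ φ.source →
    μ E = ∫⁻ x in φ '' E, ‖coeff Ω φ x‖ₑ ∂(haarPadic p n)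

end Forms

section Group

variable {G : Type*} [Group G] [TopologicalSpace G] [ChartedSpace (Fin n → ℚ_[p]) G]

/-- `Ω` is left-invariant: `ℓ_h^* Ω = Ω` for every left translation `ℓ_h`. -/
def IsLeftInvariantForm (Ω : TopForm p n G) : Prop :=
  ∀ h : G, pullback (fun g => h * g) Ω = Ω

/-- Left translation by `g` read in charts, `ζ_φ(g; x) = φ (g * φ₀⁻¹(x))`. -/
def zeta (φ₀ φ : OpenPartialHomeomorph G (Fin n → ℚ_[p])) (g : G) (x : Fin n → ℚ_[p]) :
    Fin n → ℚ_[p] :=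
  φ (g * φ₀.symm x)

/-- The Jacobian determinant of `ζ_φ(g; ·)` at `φ₀(e)`. -/
def jac (φ₀ φ : OpenPartialHomeomorph G (Fin n → ℚ_[p])) (g : G) : ℚ_[p] :=
  (fderiv ℚ_[p] (zeta φ₀ φ g) (φ₀ 1)).det

/-- The form with local coefficients `(jac φ₀ φ g)⁻¹`, where at each `g` the preferred chart `φ`
at `g` of the manifold structure is used. -/
def jacobianForm (φ₀ : OpenPartialHomeomorph G (Fin n → ℚ_[p])) : TopForm p n G := fun g =>
  (jac φ₀ (chartAt (Fin n → ℚ_[p]) g) g)⁻¹ • coordForm (chartAt (Fin n → ℚ_[p]) g) g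

/-- The formula for the Haar measure in the chart `φ`:
`μ (E ∩ U) = ∫_{φ(E ∩ U)} |jac φ₀ φ (φ⁻¹(y))|⁻¹ dλ(y)` for all Borel sets `E`, where `U` is the
domain of `φ`. -/
def HasJacobianDensity [MeasurableSpace G] (φ₀ φ : OpenPartialHomeomorph G (Fin n → ℚ_[p]))
    (μ : Measure G) : Prop :=
  ∀ E : Set G, MeasurableSet E →
    μ (E ∩ φ.source) =
      ∫⁻ y in φ '' (E ∩ φ.source), ENNReal.ofReal (‖jac φ₀ φ (φ.symm y)‖⁻¹) ∂(haarPadic p n)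

variable [ContMDiffMul 𝓘(ℚ_[p], Fin n → ℚ_[p]) ω G]

theorem bijective_mulInvariantVectorField (g : G) :
    Function.Bijective
      (mfderiv 𝓘(ℚ_[p], Fin n → ℚ_[p]) 𝓘(ℚ_[p], Fin n → ℚ_[p]) (fun x : G => g * x) 1) := by
  have D : ∀ a b : G, MDifferentiableAt 𝓘(ℚ_[p], Fin n → ℚ_[p]) 𝓘(ℚ_[p], Fin n → ℚ_[p])
      (fun x : G => a * x) b := fun a b =>
    (contMDiffAt_mul_left (n := ω)).mdifferentiableAt (by simp)
  have key : ∀ a b : G, Function.LeftInverse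
      (mfderiv 𝓘(ℚ_[p], Fin n → ℚ_[p]) 𝓘(ℚ_[p], Fin n → ℚ_[p]) (fun x : G => a⁻¹ * x) (a * b))
      (mfderiv 𝓘(ℚ_[p], Fin n → ℚ_[p]) 𝓘(ℚ_[p], Fin n → ℚ_[p]) (fun x : G => a * x) b) := by
    intro a b v
    have h := mfderiv_comp (I := 𝓘(ℚ_[p], Fin n → ℚ_[p])) (I' := 𝓘(ℚ_[p], Fin n → ℚ_[p]))
      (I'' := 𝓘(ℚ_[p], Fin n → ℚ_[p])) b (D a⁻¹ (a * b)) (D a b)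
    have e : (fun x : G => a⁻¹ * x) ∘ (fun x : G => a * x) = id := by ext x; simp
    rw [e, mfderiv_id] at h
    exact (congrArg (fun L => L v) h).symm
  refine ⟨(key g 1).injective, ?_⟩
  have h := key g⁻¹ (g * 1)
  rw [inv_inv, inv_mul_cancel_left] at h
  exact h.surjective

/-- Left translation by `g` as an isomorphism of the tangent space at the identity onto the
tangent space at `g`. -/
def translationEquiv (g : G) :
    TangentSpace 𝓘(ℚ_[p], Fin n → ℚ_[p]) (1 : G) ≃ₗ[ℚ_[p]]
      TangentSpace 𝓘(ℚ_[p], Fin n → ℚ_[p]) g :=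
  LinearEquiv.ofBijective
    (mfderiv 𝓘(ℚ_[p], Fin n → ℚ_[p]) 𝓘(ℚ_[p], Fin n → ℚ_[p]) (fun x : G => g * x) 1).toLinearMap
    (bijective_mulInvariantVectorField g)

/-- The frame at `g` of the left-invariant vector fields that extend the basis `b` of the tangent
space at the identity. -/
def invFrame (b : Module.Basis (Fin n) ℚ_[p] (TangentSpace 𝓘(ℚ_[p], Fin n → ℚ_[p]) (1 : G)))
    (g : G) : Module.Basis (Fin n) ℚ_[p] (TangentSpace 𝓘(ℚ_[p], Fin n → ℚ_[p]) g) :=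
  b.map (translationEquiv g)

theorem invFrame_apply
    (b : Module.Basis (Fin n) ℚ_[p] (TangentSpace 𝓘(ℚ_[p], Fin n → ℚ_[p]) (1 : G)))
    (g : G) (j : Fin n) : invFrame b g j = mulInvariantVectorField (b j) g := rfl

/-- The form `ω₁ ∧ … ∧ ωₙ`, where `ω₁, …, ωₙ` are the `1`-forms dual to the left-invariant vector
fields that extend the basis `b` of the tangent space at the identity. -/
def invForm (b : Module.Basis (Fin n) ℚ_[p] (TangentSpace 𝓘(ℚ_[p], Fin n → ℚ_[p]) (1 : G))) :
    TopForm p n G :=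
  fun g => wedge fun i => (invFrame b g).coord i

end Group

end PadicLie

end

/-!
For a basis `b` of the tangent space at the identity, left translations carry `b` to a basis of
every tangent space, and `invForm b` is the form with value `1` on all these bases. A left-invariant
form is therefore determined by its value on `b`, which gives the left-invariance of `invForm b` and
the uniqueness up to a scalar (`IsLeftInvariantForm.eq_smul_invForm`). When `b` is the basis of
coordinate vectors of `φ₀`, the value of `dx₁ ∧ … ∧ dxₙ` on the translated basis is `jac φ₀ φ`
(`jac_eq_coordForm_invFrame`); so `jacobianForm φ₀` is the invariant form of this basis
(`jacobianForm_eq_invForm`), which proves everything that is claimed about it except analyticity.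
The Jacobian is the determinant of a partial derivative of the multiplication read in charts, hence
analytic (`isAnalyticForm_jacobianForm`), and so are all invariant forms, being multiples of one
another.

The measures rest on the change of variables formula over `ℚ_[p]`. A map whose derivative at a point
is the identity maps the small balls around this point onto balls of the same radius, by the
ultrametric inequality and the fixed point theorem (`image_closedBall_of_norm_sub_sub_le`), and so
preserves the Haar measure near this point, balls being a generating `π`-system. Together with the
linear case, which follows from transvections and diagonal matrices, a map with invertible
derivative scales the Haar measure near each point by the absolute value of its Jacobian, which is
locally constant (`measure_image_eq_setLIntegral_enorm_det_fderiv`).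

Applied to changes of charts, the formula shows that the chart measures of an analytic form agree on
the overlaps and can be glued (`hasFormDensity_inducedMeasure`). Applied to left translations, it
shows that the measure of a left-invariant form is left-invariant
(`isMulLeftInvariant_of_hasFormDensity`). Uniqueness of the Haar measure requires a topological
group; the inversion is continuous by the implicit function theorem
(`isTopologicalGroup_of_contMDiffMul`).
-/

namespace PadicLie

open Metric Matrix Topology
open scoped Pointwise

/-! ### Scaling of the Haar measure on `ℚ_[p]` -/

section Line

variable {p : ℕ} [Fact p.Prime]

theorem addHaarMeasure_closedBall_one :
    Measure.addHaarMeasure (integersCompact p) (closedBall 0 1) = 1 :=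
  Measure.addHaarMeasure_self

theorem units_smul_closedBall (u : ℚ_[p]ˣ) :
    u • closedBall (0 : ℚ_[p]) 1 = closedBall 0 ‖(u : ℚ_[p])‖ := by
  have h := smul_closedBall (u : ℚ_[p]) (0 : ℚ_[p]) zero_le_one
  rw [smul_zero, mul_one] at h
  exact h

/-- The factor by which multiplication by `u` scales the Haar measure is the measure of the image
of the unit ball. -/
theorem distribHaarChar_eq_measure_closedBall (u : ℚ_[p]ˣ) :
    (distribHaarChar ℚ_[p] u : ℝ≥0∞) =
      Measure.addHaarMeasure (integersCompact p) (closedBall 0 ‖(u : ℚ_[p])‖) := by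
  have h := distribHaarChar_mul (Measure.addHaarMeasure (integersCompact p)) u
    (closedBall (0 : ℚ_[p]) 1)
  rwa [units_smul_closedBall, addHaarMeasure_closedBall_one, mul_one] at h

/-- The unit ball is the disjoint union of the `p` cosets of `p ℤ_[p]`. -/
theorem closedBall_one_eq_iUnion :
    closedBall (0 : ℚ_[p]) 1 =
      ⋃ i : Fin p, (fun x => (-((i : ℕ) : ℚ_[p])) + x) ⁻¹' closedBall 0 ‖(p : ℚ_[p])‖ := by
  have hp : ‖(p : ℚ_[p])‖ ≤ 1 := by exact_mod_cast Padic.norm_int_le_one (p : ℤ)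
  ext x
  simp only [mem_closedBall_zero_iff, mem_iUnion, mem_preimage]
  constructor
  · intro hx
    obtain ⟨m, hm, h⟩ := PadicInt.exists_mem_range (⟨x, hx⟩ : ℤ_[p])
    refine ⟨⟨m, hm⟩, ?_⟩
    rw [PadicInt.maximalIdeal_eq_span_p, Ideal.mem_span_singleton] at h
    obtain ⟨c, hc⟩ := h
    have hc' : x - m = p * (c : ℚ_[p]) := by exact_mod_cast congrArg ((↑) : ℤ_[p] → ℚ_[p]) hc
    rw [neg_add_eq_sub]
    change ‖x - m‖ ≤ _
    rw [hc', norm_mul]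
    exact mul_le_of_le_one_right (norm_nonneg _) c.2
  · rintro ⟨i, hi⟩
    have h1 : ‖((i : ℕ) : ℚ_[p])‖ ≤ 1 := by
      exact_mod_cast Padic.norm_int_le_one ((i : ℕ) : ℤ)
    have := Padic.nonarchimedean (((i : ℕ) : ℚ_[p])) (-((i : ℕ) : ℚ_[p]) + x)
    rw [add_neg_cancel_left] at this
    exact this.trans (max_le h1 (hi.trans hp))

/-- The `p` cosets of `p ℤ_[p]` in `ℤ_[p]` have the same measure. -/
theorem measure_closedBall_norm_p :
    Measure.addHaarMeasure (integersCompact p) (closedBall 0 ‖(p : ℚ_[p])‖) =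
      ‖(p : ℚ_[p])‖ₑ := by
  have hp0 : (p : ℝ≥0∞) ≠ 0 := by exact_mod_cast (Fact.out : p.Prime).ne_zero
  have key := addHaarMeasure_closedBall_one (p := p)
  rw [closedBall_one_eq_iUnion, measure_iUnion] at key
  · simp only [measure_preimage_add, tsum_fintype, Finset.sum_const, Finset.card_univ,
      Fintype.card_fin, nsmul_eq_mul] at key
    rw [ENNReal.eq_inv_of_mul_eq_one_left ((mul_comm _ _).trans key), ← ofReal_norm,
      Padic.norm_p, ENNReal.ofReal_inv_of_pos
        (by exact_mod_cast (Fact.out : p.Prime).pos), ENNReal.ofReal_natCast]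
  · intro i j hij
    refine Set.disjoint_left.2 fun x hi hj => hij ?_
    simp only [mem_preimage, mem_closedBall_zero_iff] at hi hj
    have h : ‖(((i : ℕ) - (j : ℕ) : ℤ) : ℚ_[p])‖ < 1 := by
      have := Padic.nonarchimedean (-((j : ℕ) : ℚ_[p]) + x) (-(-((i : ℕ) : ℚ_[p]) + x))
      rw [norm_neg] at this
      push_cast
      calc _ = ‖-((j : ℕ) : ℚ_[p]) + x + -(-((i : ℕ) : ℚ_[p]) + x)‖ := by congr 1; ring
        _ ≤ _ := this.trans (max_le hj hi)
        _ < 1 := Padic.norm_p_lt_one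
    rw [Padic.norm_intCast_lt_one_iff] at h
    have h2 : ((i : ℕ) : ℤ) - (j : ℕ) = 0 := by
      refine Int.eq_zero_of_abs_lt_dvd h ?_
      rw [abs_lt]
      have := i.2
      have := j.2
      omega
    ext
    omega
  · intro i
    exact (measurable_const_add _) isClosed_closedBall.measurableSet

theorem distribHaarChar_padic (u : ℚ_[p]ˣ) :
    (distribHaarChar ℚ_[p] u : ℝ≥0∞) = ‖(u : ℚ_[p])‖ₑ := by
  have hp : (p : ℚ_[p]) ≠ 0 := by exact_mod_cast (Fact.out : p.Prime).ne_zero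
  have h1 : distribHaarChar ℚ_[p] (Units.mk0 (p : ℚ_[p]) hp) = ‖(p : ℚ_[p])‖₊ := by
    rw [← ENNReal.coe_inj, distribHaarChar_eq_measure_closedBall]
    exact measure_closedBall_norm_p
  -- the left side depends on `‖u‖` only, and `u` has the norm of a power of `p`
  have h2 : ‖(u : ℚ_[p])‖ = ‖((Units.mk0 (p : ℚ_[p]) hp ^ (u : ℚ_[p]).valuation : ℚ_[p]ˣ) :
      ℚ_[p])‖ := by
    rw [Units.val_zpow_eq_zpow_val, Units.val_mk0, Padic.norm_p_zpow,
      Padic.norm_eq_zpow_neg_valuation u.ne_zero]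
  rw [distribHaarChar_eq_measure_closedBall, h2, ← distribHaarChar_eq_measure_closedBall,
    map_zpow, h1, ← ofReal_norm, h2, Units.val_zpow_eq_zpow_val, Units.val_mk0, norm_zpow,
    ← ENNReal.ofReal_coe_nnreal, NNReal.coe_zpow, coe_nnnorm]

theorem measure_preimage_mul_padic {a : ℚ_[p]} (ha : a ≠ 0) (s : Set ℚ_[p]) :
    ‖a‖ₑ * Measure.addHaarMeasure (integersCompact p) ((a * ·) ⁻¹' s) =
      Measure.addHaarMeasure (integersCompact p) s := by
  have h := distribHaarChar_mul (Measure.addHaarMeasure (integersCompact p)) (Units.mk0 a ha)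
    ((a * ·) ⁻¹' s)
  rw [distribHaarChar_padic] at h
  refine h.trans (congrArg _ ?_)
  change (Units.mk0 a ha) • ((fun x => (Units.mk0 a ha) • x) ⁻¹' s) = s
  rw [Set.preimage_smul, smul_inv_smul]

end Line

/-! ### Linear changes of variables -/

section Linear

variable {p : ℕ} [Fact p.Prime] {n : ℕ}

instance : (haarPadic p n).IsAddHaarMeasure := by
  unfold haarPadic; infer_instance

instance : SigmaFinite (haarPadic p n) := by
  unfold haarPadic; infer_instance

theorem enorm_det_smul_map_diagonal {D : Fin n → ℚ_[p]} (h : det (diagonal D) ≠ 0) :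
    ‖det (diagonal D)‖ₑ • Measure.map (toLin' (diagonal D)) (haarPadic p n) = haarPadic p n := by
  refine (Measure.pi_eq fun s hs => ?_).symm
  rw [Measure.smul_apply, Measure.map_apply _ (MeasurableSet.univ_pi hs)]
  swap; · exact (LinearMap.continuous_of_finiteDimensional _).measurable
  have : (toLin' (diagonal D) ⁻¹' Set.pi Set.univ fun i => s i) =
      Set.pi Set.univ fun i => (D i * ·) ⁻¹' s i := by
    ext f
    simp [diagonal_toLin']
  rw [det_diagonal] at h ⊢
  rw [this, haarPadic, Measure.pi_pi, enorm_eq_nnnorm, nnnorm_prod, ENNReal.ofNNReal_finsetProd,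
    smul_eq_mul, ← Finset.prod_mul_distrib]
  exact Finset.prod_congr rfl fun i _ =>
    measure_preimage_mul_padic (Finset.prod_ne_zero_iff.1 h i (Finset.mem_univ i)) _

/-- Along the coordinate where there is a shearing, a transvection acts as a translation. -/
theorem measurePreserving_transvection (t : TransvectionStruct (Fin n) ℚ_[p]) :
    MeasurePreserving (toLin' t.toMatrix) (haarPadic p n) (haarPadic p n) := by
  have ht : Measurable (toLin' t.toMatrix) :=
    (toLin' t.toMatrix).continuous_of_finiteDimensional.measurable
  refine ⟨ht, ?_⟩
  refine (Measure.pi_eq fun s hs ↦ ?_).symm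
  have h2s : MeasurableSet (univ.pi s) := .pi countable_univ fun i _ ↦ hs i
  simp_rw [← Measure.pi_pi, ← lintegral_indicator_one h2s]
  rw [lintegral_map (measurable_one.indicator h2s) ht, haarPadic]
  refine lintegral_eq_of_lmarginal_eq {t.i} ((measurable_one.indicator h2s).comp ht)
    (measurable_one.indicator h2s) ?_
  simp_rw [lmarginal_singleton]
  ext x
  cases t with | mk t_i t_j t_hij t_c =>
  simp [transvection, single_mulVec, t_hij.symm, ← Function.update_add,
    lintegral_add_right_eq_self fun xᵢ ↦ indicator (univ.pi s) 1 (Function.update x t_i xᵢ)]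

/-- The determinant scales the Haar measure, since diagonal matrices and transvections generate
all invertible matrices. -/
theorem enorm_det_smul_map_matrix {M : Matrix (Fin n) (Fin n) ℚ_[p]} (hM : det M ≠ 0) :
    ‖det M‖ₑ • Measure.map (toLin' M) (haarPadic p n) = haarPadic p n := by
  refine diagonal_transvection_induction_of_det_ne_zero
    (fun M => ‖det M‖ₑ • Measure.map (toLin' M) (haarPadic p n) = haarPadic p n) M hM
    (fun D hD => enorm_det_smul_map_diagonal hD) ?_ ?_
  · intro t
    simp only [TransvectionStruct.det, enorm_one, one_smul,
      (measurePreserving_transvection t).map_eq]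
  · intro A B _ _ IHA IHB
    have hc : ∀ M : Matrix (Fin n) (Fin n) ℚ_[p], Measurable (toLin' M) := fun M =>
      (LinearMap.continuous_of_finiteDimensional _).measurable
    rw [toLin'_mul, det_mul, LinearMap.coe_comp, ← Measure.map_map (hc A) (hc B), enorm_mul,
      mul_smul, ← Measure.map_smul, IHB, IHA]

theorem measure_image_continuousLinearEquiv
    (A : (Fin n → ℚ_[p]) ≃L[ℚ_[p]] (Fin n → ℚ_[p])) {s : Set (Fin n → ℚ_[p])}
    (hs : MeasurableSet s) :
    haarPadic p n (A '' s) =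
      ‖(A : (Fin n → ℚ_[p]) →L[ℚ_[p]] (Fin n → ℚ_[p])).det‖ₑ * haarPadic p n s := by
  have hdet : (A : (Fin n → ℚ_[p]) →L[ℚ_[p]] (Fin n → ℚ_[p])).det =
      det (LinearMap.toMatrix' (A.toLinearEquiv : (Fin n → ℚ_[p]) →ₗ[ℚ_[p]] (Fin n → ℚ_[p]))) := by
    rw [LinearMap.det_toMatrix']; rfl
  have hne : (A : (Fin n → ℚ_[p]) →L[ℚ_[p]] (Fin n → ℚ_[p])).det ≠ 0 :=
    (LinearEquiv.isUnit_det' A.toLinearEquiv).ne_zero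
  rw [hdet] at hne ⊢
  have h := enorm_det_smul_map_matrix hne
  rw [toLin'_toMatrix'] at h
  have hs' : MeasurableSet (A '' s) := A.toHomeomorph.measurableEmbedding.measurableSet_image.2 hs
  conv_lhs => rw [← h]
  rw [Measure.smul_apply, smul_eq_mul, Measure.map_apply
    (LinearMap.continuous_of_finiteDimensional _).measurable hs']
  congr 2
  exact preimage_image_eq s A.injective

end Linear

/-! ### Measures and local homeomorphisms -/

section Local

variable {X Y : Type*} [TopologicalSpace X] [MeasurableSpace X] [BorelSpace X]
  [TopologicalSpace Y] [MeasurableSpace Y] [BorelSpace Y]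

/-- Measures that agree near every point of a set agree on it, as countably many of the
neighbourhoods cover it. -/
theorem restrict_eq_restrict_of_locally [SecondCountableTopology X] {μ ν : Measure X} {s : Set X}
    (h : ∀ x ∈ s, ∃ U ∈ 𝓝 x, ∀ A ⊆ U ∩ s, MeasurableSet A → μ A = ν A) (hs : MeasurableSet s) :
    μ.restrict s = ν.restrict s := by
  choose! U hU h using h
  obtain ⟨t, hts, htc, hst⟩ := TopologicalSpace.countable_cover_nhdsWithin
    (f := fun x => interior (U x) ∩ s) (s := s)
    fun x hx => Filter.inter_mem (mem_nhdsWithin_of_mem_nhds (interior_mem_nhds.2 (hU x hx)))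
      self_mem_nhdsWithin
  refine Measure.restrict_congr_mono hst
    ((Measure.restrict_biUnion_congr htc).2 fun x hx => Measure.ext fun A hA => ?_)
  rw [Measure.restrict_apply hA, Measure.restrict_apply hA]
  exact h x (hts hx) _ (fun y hy => ⟨interior_subset hy.2.1, hy.2.2⟩)
    (hA.inter (isOpen_interior.measurableSet.inter hs))

theorem eq_of_forall_open_eq [SecondCountableTopology X] {μ ν : Measure X}
    (h : ∀ x : X, ∃ U, IsOpen U ∧ x ∈ U ∧ ∀ s ⊆ U, MeasurableSet s → μ s = ν s) : μ = ν := by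
  rw [← Measure.restrict_univ (μ := μ), ← Measure.restrict_univ (μ := ν)]
  refine restrict_eq_restrict_of_locally (fun x _ => ?_) MeasurableSet.univ
  obtain ⟨U, hU, hx, hs⟩ := h x
  exact ⟨U, hU.mem_nhds hx, fun s hsU => hs s (hsU.trans inter_subset_left)⟩

theorem measurableSet_image_openPartialHomeomorph (e : OpenPartialHomeomorph X Y) {s : Set X}
    (hs : MeasurableSet s) (hse : s ⊆ e.source) : MeasurableSet (e '' s) := by
  have h := e.isOpenEmbedding_restrict.measurableEmbedding.measurableSet_image.2
    (measurable_subtype_coe hs : MeasurableSet (((↑) : e.source → X) ⁻¹' s))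
  convert h using 1
  ext y
  constructor
  · rintro ⟨x, hx, rfl⟩
    exact ⟨⟨x, hse hx⟩, hx, rfl⟩
  · rintro ⟨⟨x, hx⟩, hxs, rfl⟩
    exact ⟨x, hxs, rfl⟩

theorem map_symm_restrict_target_apply (e : OpenPartialHomeomorph X Y) (μ : Measure Y)
    {s : Set X} (hs : MeasurableSet s) :
    (μ.restrict e.target).map e.symm s = μ (e '' (s ∩ e.source)) := by
  rw [Measure.map_apply_of_aemeasurable
    (e.continuousOn_symm.aemeasurable e.open_target.measurableSet) hs, inter_comm,
    e.image_source_inter_eq', inter_comm, Measure.restrict_apply']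
  exact e.open_target.measurableSet

end Local

/-! ### Differentiable changes of variables -/

section Balls

variable {E : Type*} [NormedAddCommGroup E] [IsUltrametricDist E]

/-- A map that differs from the identity by a contraction maps balls onto balls of the same
radius: it is an isometry by the ultrametric inequality, and onto by the fixed point theorem. -/
theorem image_closedBall_of_norm_sub_sub_le [CompleteSpace E] {f : E → E} {a : E} {r : ℝ}
    (hr : 0 ≤ r) (hf : ∀ x ∈ closedBall a r, ∀ y ∈ closedBall a r,
      ‖f x - f y - (x - y)‖ ≤ (1 / 2 : ℝ≥0) * ‖x - y‖) :
    f '' closedBall a r = closedBall (f a) r := by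
  have ha : a ∈ closedBall a r := mem_closedBall_self hr
  have hc : ((1 / 2 : ℝ≥0) : ℝ) ≤ 1 := by norm_num
  refine Subset.antisymm ?_ fun z hz => ?_
  · rintro _ ⟨x, hx, rfl⟩
    rw [mem_closedBall, dist_eq_norm] at hx ⊢
    have h := hf x (by rwa [mem_closedBall, dist_eq_norm]) a ha
    calc ‖f x - f a‖ = ‖(f x - f a - (x - a)) + (x - a)‖ := by rw [sub_add_cancel]
      _ ≤ max ‖f x - f a - (x - a)‖ ‖x - a‖ := IsUltrametricDist.norm_add_le_max _ _
      _ ≤ r := max_le ((h.trans (mul_le_of_le_one_left (norm_nonneg _) hc)).trans hx) hx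
  · -- a solution of `f u = z` is a fixed point of `u ↦ u - (f u - z)`
    have hT : MapsTo (fun u => u - (f u - z)) (closedBall a r) (closedBall a r) := by
      intro u hu
      have h := hf u hu a ha
      rw [mem_closedBall, dist_eq_norm] at hu hz ⊢
      calc ‖u - (f u - z) - a‖ = ‖(z - f a) - (f u - f a - (u - a))‖ := by congr 1; abel
        _ ≤ max ‖z - f a‖ ‖f u - f a - (u - a)‖ := by
          rw [sub_eq_add_neg, ← norm_neg (f u - f a - (u - a))]
          exact IsUltrametricDist.norm_add_le_max _ _
        _ ≤ r := max_le hz ((h.trans (mul_le_of_le_one_left (norm_nonneg _) hc)).trans hu)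
    have hK : ContractingWith (1 / 2) (hT.restrict _ _ _) := by
      refine ⟨by norm_num, LipschitzWith.of_dist_le_mul ?_⟩
      rintro ⟨x, hx⟩ ⟨y, hy⟩
      rw [Subtype.dist_eq, Subtype.dist_eq, dist_eq_norm, dist_eq_norm]
      refine le_trans (le_of_eq ?_) (hf x hx y hy)
      rw [← norm_neg]
      congr 1
      simp only [MapsTo.val_restrict_apply]
      abel
    obtain ⟨u, hu, hfix, -⟩ := hK.exists_fixedPoint' isClosed_closedBall.isComplete hT ha
      (edist_ne_top _ _)
    refine ⟨u, hu, ?_⟩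
    have : u - (f u - z) = u := hfix
    rwa [sub_eq_self, sub_eq_zero] at this

theorem closedBall_inter_closedBall {x y a : E} {s r : ℝ}
    (h : y ∈ closedBall x s ∩ closedBall a r) :
    closedBall x s ∩ closedBall a r = closedBall y (min s r) := by
  rw [IsUltrametricDist.closedBall_eq_of_mem h.1, IsUltrametricDist.closedBall_eq_of_mem h.2]
  ext z
  simp

variable (E) in
theorem isTopologicalBasis_closedBall :
    TopologicalSpace.IsTopologicalBasis {B : Set E | ∃ x : E, ∃ r > 0, B = closedBall x r} := by
  refine TopologicalSpace.isTopologicalBasis_of_isOpen_of_nhds ?_ fun x u hx hu => ?_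
  · rintro _ ⟨x, r, hr, rfl⟩
    exact IsUltrametricDist.isOpen_closedBall x hr.ne'
  · obtain ⟨r, hr, h⟩ := nhds_basis_closedBall.mem_iff.1 (hu.mem_nhds hx)
    exact ⟨_, ⟨x, r, hr, rfl⟩, mem_closedBall_self hr.le, h⟩

variable (E) in
theorem isPiSystem_closedBall : IsPiSystem {B : Set E | ∃ x : E, ∃ r > 0, B = closedBall x r} := by
  rintro _ ⟨x, r, hr, rfl⟩ _ ⟨y, s, hs, rfl⟩ ⟨z, hz⟩
  exact ⟨z, min r s, lt_min hr hs, closedBall_inter_closedBall hz⟩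

variable [MeasurableSpace E] [BorelSpace E] [SecondCountableTopology E]

/-- In an ultrametric space the balls form a `π`-system, so that a measure on a ball is determined
by its values on the smaller balls. -/
theorem restrict_closedBall_eq_of_forall_closedBall {μ ν : Measure E} {a : E} {r : ℝ} (hr : 0 < r)
    (hμ : μ (closedBall a r) ≠ ⊤)
    (h : ∀ y ∈ closedBall a r, ∀ s, 0 < s → s ≤ r → μ (closedBall y s) = ν (closedBall y s)) :
    μ.restrict (closedBall a r) = ν.restrict (closedBall a r) := by
  have : IsFiniteMeasure (μ.restrict (closedBall a r)) :=
    isFiniteMeasure_restrict.2 hμ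
  refine ext_of_generate_finite _
    (BorelSpace.measurable_eq.trans (isTopologicalBasis_closedBall E).borel_eq_generateFrom)
    (isPiSystem_closedBall E) ?_ ?_
  · rintro _ ⟨x, s, hs, rfl⟩
    rw [Measure.restrict_apply isClosed_closedBall.measurableSet,
      Measure.restrict_apply isClosed_closedBall.measurableSet]
    rcases (closedBall x s ∩ closedBall a r).eq_empty_or_nonempty with h0 | ⟨y, hy⟩
    · simp [h0]
    · rw [closedBall_inter_closedBall hy]
      exact h y hy.2 _ (lt_min hs hr) (min_le_right _ _)
  · rw [Measure.restrict_apply_univ, Measure.restrict_apply_univ]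
    exact h a (mem_closedBall_self hr.le) r hr le_rfl

end Balls

section ChangeOfVariables

variable {p : ℕ} [Fact p.Prime] {n : ℕ}

theorem haarPadic_closedBall_eq (x y : Fin n → ℚ_[p]) (r : ℝ) :
    haarPadic p n (closedBall x r) = haarPadic p n (closedBall y r) := by
  have : closedBall x r = (fun z => (y - x) + z) ⁻¹' closedBall y r := by
    ext z
    simp only [mem_closedBall, mem_preimage, dist_eq_norm]
    congr! 2
    abel
  rw [this, measure_preimage_add]

/-- Near a point where its derivative is the identity, a map preserves the Haar measure. -/
theorem exists_measure_image_eq_of_hasStrictFDerivAt_id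
    (F : OpenPartialHomeomorph (Fin n → ℚ_[p]) (Fin n → ℚ_[p])) {a : Fin n → ℚ_[p]}
    (ha : a ∈ F.source) (h : HasStrictFDerivAt F (ContinuousLinearMap.id ℚ_[p] _) a) :
    ∃ U ∈ 𝓝 a, U ⊆ F.source ∧
      ∀ s ⊆ U, MeasurableSet s → haarPadic p n (F '' s) = haarPadic p n s := by
  obtain ⟨t, ht, hF⟩ := h.approximates_deriv_on_nhds (c := 1 / 2) (Or.inr (by norm_num))
  obtain ⟨r, hr, hrt⟩ := nhds_basis_closedBall.mem_iff.1
    (Filter.inter_mem ht (F.open_source.mem_nhds ha))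
  refine ⟨closedBall a r, closedBall_mem_nhds a hr, fun x hx => (hrt hx).2, fun s hs hsm => ?_⟩
  have key : (haarPadic p n).restrict (closedBall a r) =
      (((haarPadic p n).restrict F.target).map F.symm).restrict (closedBall a r) := by
    refine restrict_closedBall_eq_of_forall_closedBall hr
      (isCompact_closedBall a r).measure_lt_top.ne fun y hy s hs hsr => ?_
    have hsub : closedBall y s ⊆ closedBall a r := by
      rw [IsUltrametricDist.closedBall_eq_of_mem hy]
      exact closedBall_subset_closedBall hsr
    rw [map_symm_restrict_target_apply _ _ isClosed_closedBall.measurableSet,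
      inter_eq_left.2 fun x hx => (hrt (hsub hx)).2,
      image_closedBall_of_norm_sub_sub_le hs.le fun x hx y hy =>
        hF x (hrt (hsub hx)).1 y (hrt (hsub hy)).1]
    exact haarPadic_closedBall_eq _ _ _
  have := congrArg (fun μ : Measure _ => μ s) key
  simp only [Measure.restrict_apply hsm, inter_eq_left.2 hs] at this
  rw [this, map_symm_restrict_target_apply _ _ hsm, inter_eq_left.2 fun x hx => (hrt (hs hx)).2]

/-- Near a point where its derivative `F'` is invertible, a map scales the Haar measure by exactly
`|det F'|`: composed with the inverse of `F'` it preserves the measure. -/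
theorem exists_measure_image_eq_of_hasStrictFDerivAt
    (F : OpenPartialHomeomorph (Fin n → ℚ_[p]) (Fin n → ℚ_[p])) {a : Fin n → ℚ_[p]}
    (ha : a ∈ F.source) {F' : (Fin n → ℚ_[p]) →L[ℚ_[p]] (Fin n → ℚ_[p])}
    (h : HasStrictFDerivAt F F' a) (h' : F'.det ≠ 0) :
    ∃ U ∈ 𝓝 a, U ⊆ F.source ∧
      ∀ s ⊆ U, MeasurableSet s → haarPadic p n (F '' s) = ‖F'.det‖ₑ * haarPadic p n s := by
  set A := F'.toContinuousLinearEquivOfDetNeZero h'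
  have hA : (A : (Fin n → ℚ_[p]) →L[ℚ_[p]] (Fin n → ℚ_[p])) = F' := by ext; rfl
  have hG : HasStrictFDerivAt (F.transHomeomorph A.symm.toHomeomorph)
      (ContinuousLinearMap.id ℚ_[p] _) a := by
    have h1 := A.symm.hasStrictFDerivAt (x := F a) |>.comp a h
    rw [← hA, ContinuousLinearEquiv.coe_symm_comp_coe] at h1
    exact h1
  obtain ⟨U, hU, hUF, H⟩ := exists_measure_image_eq_of_hasStrictFDerivAt_id
    (F.transHomeomorph A.symm.toHomeomorph) ha hG
  refine ⟨U, hU, hUF, fun s hs hsm => ?_⟩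
  have hsG := measurableSet_image_openPartialHomeomorph
    (F.transHomeomorph A.symm.toHomeomorph) hsm (hs.trans hUF)
  have h2 := measure_image_continuousLinearEquiv A hsG
  rw [H s hs hsm, hA, ← image_comp] at h2
  rw [← h2]
  exact congrArg _ (image_congr fun x _ => (A.apply_symm_apply (F x)).symm)

theorem eventually_norm_eq {X : Type*} [TopologicalSpace X] {f : X → ℚ_[p]} {a : X}
    (hf : ContinuousAt f a) (ha : f a ≠ 0) : ∀ᶠ x in 𝓝 a, ‖f x‖ = ‖f a‖ := by
  filter_upwards [hf (ball_mem_nhds _ (norm_pos_iff.2 ha))] with x hx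
  rw [mem_preimage, mem_ball, dist_eq_norm] at hx
  exact Padic.norm_eq_of_norm_sub_lt_right hx

/-- The change of variables formula for the indicator function of a set. -/
theorem measure_image_eq_setLIntegral_enorm_det_fderiv
    (F : OpenPartialHomeomorph (Fin n → ℚ_[p]) (Fin n → ℚ_[p]))
    (hF : ∀ x ∈ F.source, AnalyticAt ℚ_[p] F x)
    (hF' : ∀ x ∈ F.source, (fderiv ℚ_[p] F x).det ≠ 0)
    {s : Set (Fin n → ℚ_[p])} (hs : MeasurableSet s) (hsF : s ⊆ F.source) :
    haarPadic p n (F '' s) = ∫⁻ x in s, ‖(fderiv ℚ_[p] F x).det‖ₑ ∂(haarPadic p n) := by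
  have key : (((haarPadic p n).restrict F.target).map F.symm).restrict F.source =
      ((haarPadic p n).withDensity fun x => ‖(fderiv ℚ_[p] F x).det‖ₑ).restrict F.source := by
    refine restrict_eq_restrict_of_locally (fun a ha => ?_) F.open_source.measurableSet
    obtain ⟨U, hU, hUF, H⟩ := exists_measure_image_eq_of_hasStrictFDerivAt F ha
      (hF a ha).hasStrictFDerivAt (hF' a ha)
    -- the absolute value of the Jacobian is locally constant
    have hc : ∀ᶠ x in 𝓝 a, ‖(fderiv ℚ_[p] F x).det‖ = ‖(fderiv ℚ_[p] F a).det‖ :=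
      eventually_norm_eq (ContinuousLinearMap.continuous_det.continuousAt.comp
        (hF a ha).fderiv.continuousAt) (hF' a ha)
    refine ⟨U ∩ {x | ‖(fderiv ℚ_[p] F x).det‖ = ‖(fderiv ℚ_[p] F a).det‖},
      Filter.inter_mem hU hc, fun A hA hAm => ?_⟩
    have hAU : A ⊆ U := fun x hx => (hA hx).1.1
    rw [map_symm_restrict_target_apply _ _ hAm, inter_eq_left.2 (hAU.trans hUF), H A hAU hAm,
      withDensity_apply _ hAm, ← setLIntegral_const]
    refine setLIntegral_congr_fun hAm fun x hx => ?_
    simp only [← ofReal_norm]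
    rw [(hA hx).1.2]
  have h := congrArg (fun μ : Measure _ => μ s) key
  simp only [Measure.restrict_apply hs, inter_eq_left.2 hsF, withDensity_apply _ hs] at h
  rw [← h, map_symm_restrict_target_apply _ _ hs, inter_eq_left.2 hsF]

/-- The change of variables formula for analytic diffeomorphisms between open subsets of
`ℚ_[p]^n`. -/
theorem setLIntegral_image_eq_setLIntegral_enorm_det_fderiv_mul
    (F : OpenPartialHomeomorph (Fin n → ℚ_[p]) (Fin n → ℚ_[p]))
    (hF : ∀ x ∈ F.source, AnalyticAt ℚ_[p] F x)
    (hF' : ∀ x ∈ F.source, (fderiv ℚ_[p] F x).det ≠ 0)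
    {s : Set (Fin n → ℚ_[p])} (hs : MeasurableSet s) (hsF : s ⊆ F.source)
    {g : (Fin n → ℚ_[p]) → ℝ≥0∞} (hg : ContinuousOn g F.target) :
    ∫⁻ y in F '' s, g y ∂(haarPadic p n) =
      ∫⁻ x in s, ‖(fderiv ℚ_[p] F x).det‖ₑ * g (F x) ∂(haarPadic p n) := by
  have hFs : MeasurableSet (F '' s) := measurableSet_image_openPartialHomeomorph F hs hsF
  have hFst : F '' s ⊆ F.target := image_subset_iff.2 fun x hx => F.map_source (hsF hx)
  have hgF : AEMeasurable (fun x => g (F x)) ((haarPadic p n).restrict s) :=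
    ((hg.comp F.continuousOn F.mapsTo).mono hsF).aemeasurable hs
  have hd : ContinuousOn (fun x => ‖(fderiv ℚ_[p] F x).det‖ₑ) F.source := fun x hx =>
    (continuous_enorm.continuousAt.comp (ContinuousLinearMap.continuous_det.continuousAt.comp
      (hF x hx).fderiv.continuousAt)).continuousWithinAt
  have hsymm : AEMeasurable F.symm ((haarPadic p n).restrict (F '' s)) :=
    (F.continuousOn_symm.mono hFst).aemeasurable hFs
  have h1 : ((haarPadic p n).restrict (F '' s)).map F.symm =
      ((haarPadic p n).restrict s).withDensity fun x => ‖(fderiv ℚ_[p] F x).det‖ₑ := by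
    ext t ht
    have : F.symm ⁻¹' t ∩ F '' s = F '' (t ∩ s) := by
      ext y
      constructor
      · rintro ⟨hy, x, hx, rfl⟩
        rw [mem_preimage, F.left_inv (hsF hx)] at hy
        exact ⟨x, ⟨hy, hx⟩, rfl⟩
      · rintro ⟨x, hx, rfl⟩
        refine ⟨?_, x, hx.2, rfl⟩
        rw [mem_preimage, F.left_inv (hsF hx.2)]
        exact hx.1
    rw [Measure.map_apply_of_aemeasurable hsymm ht, Measure.restrict_apply' hFs, this,
      withDensity_apply _ ht, Measure.restrict_restrict ht]
    exact measure_image_eq_setLIntegral_enorm_det_fderiv F hF hF' (ht.inter hs)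
      (inter_subset_right.trans hsF)
  calc ∫⁻ y in F '' s, g y ∂(haarPadic p n)
      = ∫⁻ y in F '' s, g (F (F.symm y)) ∂(haarPadic p n) :=
        setLIntegral_congr_fun hFs fun y hy => by simp only [F.right_inv (hFst hy)]
    _ = ∫⁻ x, g (F x) ∂(((haarPadic p n).restrict (F '' s)).map F.symm) := by
        rw [lintegral_map' _ hsymm]
        rw [h1]
        exact hgF.mono_ac (withDensity_absolutelyContinuous _ _)
    _ = _ := by
        rw [h1, lintegral_withDensity_eq_lintegral_mul₀ ((hd.mono hsF).aemeasurable hs) hgF]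
        rfl

end ChangeOfVariables

/-! ### Forms of top degree in charts -/

section TopForms

variable {p : ℕ} [Fact p.Prime] {n : ℕ}

theorem wedge_apply {V : Type*} [AddCommGroup V] [Module ℚ_[p] V]
    (θ : Fin n → (V →ₗ[ℚ_[p]] ℚ_[p])) (v : Fin n → V) :
    wedge θ v = (Pi.basisFun ℚ_[p] (Fin n)).det fun j i => θ i (v j) := rfl

/-- The wedge product of a dual basis is the determinant with respect to the basis. -/
theorem wedge_coord {V : Type*} [AddCommGroup V] [Module ℚ_[p] V]
    (B : Module.Basis (Fin n) ℚ_[p] V) : wedge B.coord = B.det := by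
  have h : wedge B.coord B = 1 := by
    rw [wedge_apply, ← (Pi.basisFun ℚ_[p] (Fin n)).det_self]
    congr 1
    ext j i
    simp [Module.Basis.repr_self, Finsupp.single_apply, Pi.single_apply, eq_comm]
  rw [AlternatingMap.eq_smul_basis_det B (wedge B.coord), h, one_smul]

local notation "𝕀" => 𝓘(ℚ_[p], Fin n → ℚ_[p])

variable {M : Type*} [TopologicalSpace M] [ChartedSpace (Fin n → ℚ_[p]) M]

/-- Tangent spaces at different points are the same space by definition, which allows rewriting
the base point of a form alone. -/
theorem topForm_congr (Ω : TopForm p n M) {g g' : M} (h : g = g') (v : Fin n → Fin n → ℚ_[p]) :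
    Ω g v = Ω g' v := by
  subst h; rfl

theorem mdifferentiable_of_mem_charts {φ : OpenPartialHomeomorph M (Fin n → ℚ_[p])}
    (hφ : φ ∈ charts p n M) : φ.MDifferentiable 𝕀 𝕀 :=
  ⟨(contMDiffOn_of_mem_maximalAtlas hφ).mdifferentiableOn (by simp),
    (contMDiffOn_symm_of_mem_maximalAtlas hφ).mdifferentiableOn (by simp)⟩

/-- The derivative at `g` of the chart `φ`, as an isomorphism of the tangent space at `g` onto the
model space. -/
noncomputable def chartDeriv {φ : OpenPartialHomeomorph M (Fin n → ℚ_[p])}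
    (hφ : φ ∈ charts p n M) {g : M} (hg : g ∈ φ.source) :
    TangentSpace 𝕀 g ≃L[ℚ_[p]] (Fin n → ℚ_[p]) :=
  (mdifferentiable_of_mem_charts hφ).mfderiv hg

/-- The basis `∂/∂x₁, …, ∂/∂xₙ` of the tangent space at `g` given by the coordinates of `φ`. -/
noncomputable def coordBasis {φ : OpenPartialHomeomorph M (Fin n → ℚ_[p])}
    (hφ : φ ∈ charts p n M) {g : M} (hg : g ∈ φ.source) :
    Module.Basis (Fin n) ℚ_[p] (TangentSpace 𝕀 g) :=
  (Pi.basisFun ℚ_[p] (Fin n)).map (chartDeriv hφ hg).symm.toLinearEquiv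

theorem coordBasis_apply {φ : OpenPartialHomeomorph M (Fin n → ℚ_[p])} (hφ : φ ∈ charts p n M)
    {g : M} (hg : g ∈ φ.source) (i : Fin n) :
    coordBasis hφ hg i = mfderiv 𝕀 𝕀 φ.symm (φ g) (Pi.single i 1 : Fin n → ℚ_[p]) := by
  rw [coordBasis, Module.Basis.map_apply, Pi.basisFun_apply]
  rfl

/-- The form `dx₁ ∧ … ∧ dxₙ` on the images of the standard basis vectors under `W` is the
determinant of `W` read in the chart. -/
theorem coordForm_comp (φ : OpenPartialHomeomorph M (Fin n → ℚ_[p])) (g : M)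
    (W : (Fin n → ℚ_[p]) →L[ℚ_[p]] TangentSpace 𝕀 g) :
    coordForm φ g (fun i => W (Pi.single i 1)) =
      ContinuousLinearMap.det (M := Fin n → ℚ_[p]) ((mfderiv 𝕀 𝕀 φ g) ∘L W) := by
  have h := (Pi.basisFun ℚ_[p] (Fin n)).det_comp
    (((mfderiv 𝕀 𝕀 φ g) ∘L W : (Fin n → ℚ_[p]) →L[ℚ_[p]] (Fin n → ℚ_[p])) :
      (Fin n → ℚ_[p]) →ₗ[ℚ_[p]] (Fin n → ℚ_[p])) (Pi.basisFun ℚ_[p] (Fin n))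
  rw [Module.Basis.det_self, mul_one] at h
  refine Eq.trans ?_ h
  rw [coordForm, wedge_apply]
  congr 1
  ext j i
  simp only [Function.comp_apply, Pi.basisFun_apply]
  rfl

theorem coordForm_eq_det {φ : OpenPartialHomeomorph M (Fin n → ℚ_[p])} (hφ : φ ∈ charts p n M)
    {g : M} (hg : g ∈ φ.source) : coordForm φ g = (coordBasis hφ hg).det := by
  rw [← wedge_coord, coordForm]
  congr 1

/-- The coefficient of a form is its value on the coordinate vectors. -/
theorem coeff_apply_chart (Ω : TopForm p n M) {φ : OpenPartialHomeomorph M (Fin n → ℚ_[p])}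
    (hφ : φ ∈ charts p n M) {g : M} (hg : g ∈ φ.source) :
    coeff Ω φ (φ g) = Ω g (coordBasis hφ hg) := by
  rw [coeff]
  refine (topForm_congr Ω (φ.left_inv hg) _).trans (congrArg (Ω g) ?_)
  ext i : 1
  exact (coordBasis_apply hφ hg i).symm

theorem topForm_eq_coeff_smul (Ω : TopForm p n M)
    {φ : OpenPartialHomeomorph M (Fin n → ℚ_[p])}
    (hφ : φ ∈ charts p n M) {g : M} (hg : g ∈ φ.source) :
    Ω g = coeff Ω φ (φ g) • coordForm φ g := by
  rw [coordForm_eq_det hφ hg, coeff_apply_chart Ω hφ hg]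
  exact AlternatingMap.eq_smul_basis_det _ _

theorem coeff_smul_coordForm {φ : OpenPartialHomeomorph M (Fin n → ℚ_[p])}
    (hφ : φ ∈ charts p n M) {Ω : TopForm p n M} {x : Fin n → ℚ_[p]} (hx : x ∈ φ.target)
    {c : ℚ_[p]} (h : Ω (φ.symm x) = c • coordForm φ (φ.symm x)) : coeff Ω φ x = c := by
  have hg := φ.map_target hx
  have h1 := coeff_apply_chart Ω hφ hg
  rw [φ.right_inv hx, h, coordForm_eq_det hφ hg] at h1
  rw [h1, AlternatingMap.smul_apply, Module.Basis.det_self, smul_eq_mul, mul_one]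

theorem coeff_const_smul (c : ℚ_[p]) (Ω : TopForm p n M)
    (φ : OpenPartialHomeomorph M (Fin n → ℚ_[p])) (x : Fin n → ℚ_[p]) :
    coeff (c • Ω) φ x = c * coeff Ω φ x := rfl

/-- The transformation rule of the coefficients of a form that is invariant under `L`. -/
theorem coeff_eq_of_pullback_eq {Ω : TopForm p n M} {L : M → M}
    (hL : MDifferentiable 𝕀 𝕀 L) (hΩ : pullback L Ω = Ω)
    {φ ψ : OpenPartialHomeomorph M (Fin n → ℚ_[p])} (hφ : φ ∈ charts p n M)
    (hψ : ψ ∈ charts p n M) {x : Fin n → ℚ_[p]} (hx : x ∈ φ.target)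
    (hLx : L (φ.symm x) ∈ ψ.source) :
    coeff Ω φ x = (fderiv ℚ_[p] (fun y => ψ (L (φ.symm y))) x).det *
      coeff Ω ψ (ψ (L (φ.symm x))) := by
  have dφ := (mdifferentiable_of_mem_charts hφ).mdifferentiableAt_symm hx
  have dψ := (mdifferentiable_of_mem_charts hψ).mdifferentiableAt hLx
  have hfd : fderiv ℚ_[p] (fun y => ψ (L (φ.symm y))) x =
      (mfderiv 𝕀 𝕀 ψ (L (φ.symm x))) ∘L
        ((mfderiv 𝕀 𝕀 L (φ.symm x)) ∘L (mfderiv 𝕀 𝕀 φ.symm x)) := by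
    have h := dψ.hasMFDerivAt.comp x ((hL _).hasMFDerivAt.comp x dφ.hasMFDerivAt)
    have h' : HasFDerivAt (fun y => ψ (L (φ.symm y)))
        ((mfderiv 𝕀 𝕀 ψ (L (φ.symm x))) ∘L
          ((mfderiv 𝕀 𝕀 L (φ.symm x)) ∘L (mfderiv 𝕀 𝕀 φ.symm x)) :
            (Fin n → ℚ_[p]) →L[ℚ_[p]] (Fin n → ℚ_[p])) x := hasMFDerivAt_iff_hasFDerivAt.1 h
    exact h'.fderiv
  rw [hfd]
  have h1 : coeff Ω φ x = Ω (L (φ.symm x)) fun i =>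
      ((mfderiv 𝕀 𝕀 L (φ.symm x)) ∘L (mfderiv 𝕀 𝕀 φ.symm x))
        (Pi.single i 1 : Fin n → ℚ_[p]) := by
    conv_lhs => rw [← hΩ]
    rfl
  rw [h1, topForm_eq_coeff_smul Ω hψ hLx, AlternatingMap.smul_apply, smul_eq_mul, mul_comm]
  congr 1
  exact coordForm_comp ψ _ _

end TopForms

/-! ### The measure induced by an analytic form -/

section FormMeasure

variable {p : ℕ} [Fact p.Prime] {n : ℕ}

local notation "𝕀" => 𝓘(ℚ_[p], Fin n → ℚ_[p])

variable {M : Type*} [TopologicalSpace M] [ChartedSpace (Fin n → ℚ_[p]) M]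

theorem analyticAt_of_contMDiffAt {f : (Fin n → ℚ_[p]) → (Fin n → ℚ_[p])} {x : Fin n → ℚ_[p]}
    (hf : ContMDiffAt 𝕀 𝕀 ω f x) : AnalyticAt ℚ_[p] f x :=
  (contMDiffAt_iff_contDiffAt.1 hf).analyticAt

/-- The integrals of a form over a set and over its image under an analytic homeomorphism that
preserves the form agree, whatever charts are used to compute them. -/
theorem setLIntegral_enorm_coeff_image {Ω : TopForm p n M} (hΩ : IsAnalyticForm Ω)
    [MeasurableSpace M] [BorelSpace M] (L : M ≃ₜ M) (hL : ContMDiff 𝕀 𝕀 ω L)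
    (hL' : ContMDiff 𝕀 𝕀 ω L.symm) (hpull : pullback L Ω = Ω)
    {φ ψ : OpenPartialHomeomorph M (Fin n → ℚ_[p])} (hφ : φ ∈ charts p n M)
    (hψ : ψ ∈ charts p n M) {s : Set M} (hs : MeasurableSet s) (hsφ : s ⊆ φ.source)
    (hsψ : L '' s ⊆ ψ.source) :
    ∫⁻ x in φ '' s, ‖coeff Ω φ x‖ₑ ∂(haarPadic p n) =
      ∫⁻ x in ψ '' (L '' s), ‖coeff Ω ψ x‖ₑ ∂(haarPadic p n) := by
  have hLd : L.toOpenPartialHomeomorph.MDifferentiable 𝕀 𝕀 :=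
    ⟨(hL.mdifferentiable (by simp)).mdifferentiableOn,
      (hL'.mdifferentiable (by simp)).mdifferentiableOn⟩
  set F := φ.symm.trans (L.toOpenPartialHomeomorph.trans ψ)
  have hF : F.MDifferentiable 𝕀 𝕀 := (mdifferentiable_of_mem_charts hφ).symm.trans
    (hLd.trans (mdifferentiable_of_mem_charts hψ))
  have hFx : ∀ x, F x = ψ (L (φ.symm x)) := fun _ => rfl
  have hsrc : ∀ x, x ∈ F.source ↔ x ∈ φ.target ∧ L (φ.symm x) ∈ ψ.source := by
    intro x
    simp [F]
  have han : ∀ x ∈ F.source, AnalyticAt ℚ_[p] F x := by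
    intro x hx
    have h1 : ContMDiffAt 𝕀 𝕀 ω (fun y => L (φ.symm y)) x := hL.contMDiffAt.comp x
      (contMDiffAt_symm_of_mem_maximalAtlas hφ ((hsrc x).1 hx).1)
    have h2 : ContMDiffAt 𝕀 𝕀 ω ψ (L (φ.symm x)) :=
      contMDiffAt_of_mem_maximalAtlas hψ ((hsrc x).1 hx).2
    have h3 := h2.comp x h1
    exact analyticAt_of_contMDiffAt h3
  have hdet : ∀ x ∈ F.source, (fderiv ℚ_[p] F x).det ≠ 0 := by
    intro x hx
    have h := (LinearEquiv.isUnit_det' (M := Fin n → ℚ_[p])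
      (hF.mfderiv hx).toLinearEquiv).ne_zero
    have e : mfderiv 𝕀 𝕀 F x = fderiv ℚ_[p] F x := mfderiv_eq_fderiv
    rw [← e]
    exact h
  have himg : F '' (φ '' s) = ψ '' (L '' s) := by
    rw [image_image, image_image]
    refine image_congr fun x hx => ?_
    rw [hFx, φ.left_inv (hsφ hx)]
  have hsF : φ '' s ⊆ F.source := by
    rintro _ ⟨x, hx, rfl⟩
    rw [hsrc, φ.left_inv (hsφ hx)]
    exact ⟨φ.map_source (hsφ hx), hsψ (mem_image_of_mem _ hx)⟩
  have hφs := measurableSet_image_openPartialHomeomorph φ hs hsφ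
  rw [← himg, setLIntegral_image_eq_setLIntegral_enorm_det_fderiv_mul F han hdet hφs hsF]
  · refine setLIntegral_congr_fun hφs fun x hx => ?_
    have hx' := (hsrc x).1 (hsF hx)
    rw [coeff_eq_of_pullback_eq (hL.mdifferentiable (by simp)) hpull hφ hψ hx'.1 hx'.2, enorm_mul]
    rfl
  · exact (hΩ ψ hψ).continuousOn.enorm.mono fun y hy => by
      have := F.map_target hy
      rw [← F.right_inv hy]
      exact ψ.map_source ((hsrc _).1 this).2

theorem pullback_id (Ω : TopForm p n M) : pullback (fun g => g) Ω = Ω := by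
  funext g
  ext v
  have h : mfderiv 𝕀 𝕀 (fun g : M => g) g = ContinuousLinearMap.id ℚ_[p] _ := mfderiv_id
  rw [pullback, h]
  rfl

variable [MeasurableSpace M] [BorelSpace M]

theorem chartMeasure_apply (Ω : TopForm p n M) (φ : OpenPartialHomeomorph M (Fin n → ℚ_[p]))
    {s : Set M} (hs : MeasurableSet s) :
    chartMeasure Ω φ s = ∫⁻ x in φ '' (s ∩ φ.source), ‖coeff Ω φ x‖ₑ ∂(haarPadic p n) := by
  rw [chartMeasure, ← restrict_withDensity φ.open_target.measurableSet,
    map_symm_restrict_target_apply _ _ hs, withDensity_apply]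
  exact measurableSet_image_openPartialHomeomorph φ (hs.inter φ.open_source.measurableSet)
    inter_subset_right

theorem chartMeasure_eq_chartMeasure {Ω : TopForm p n M} (hΩ : IsAnalyticForm Ω)
    {φ ψ : OpenPartialHomeomorph M (Fin n → ℚ_[p])} (hφ : φ ∈ charts p n M)
    (hψ : ψ ∈ charts p n M) {s : Set M} (hs : MeasurableSet s) (hsφ : s ⊆ φ.source)
    (hsψ : s ⊆ ψ.source) : chartMeasure Ω φ s = chartMeasure Ω ψ s := by
  rw [chartMeasure_apply _ _ hs, chartMeasure_apply _ _ hs, inter_eq_left.2 hsφ,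
    inter_eq_left.2 hsψ]
  have h := setLIntegral_enorm_coeff_image hΩ (Homeomorph.refl M) contMDiff_id contMDiff_id
    (pullback_id Ω) hφ hψ hs hsφ (by simpa using hsψ)
  simpa using h

variable [IsManifold 𝓘(ℚ_[p], Fin n → ℚ_[p]) ω M]

/-- A form without zeros has a positive density in every chart. -/
theorem isOpenPosMeasure_of_hasFormDensity {Ω : TopForm p n M}
    (hΩ : IsAnalyticForm Ω) (h0 : ∀ g, Ω g ≠ 0) {μ : Measure M} (hμ : HasFormDensity Ω μ) :
    μ.IsOpenPosMeasure := by
  refine ⟨fun U hU ⟨g, hg⟩ h => ?_⟩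
  set φ := chartAt (Fin n → ℚ_[p]) g
  have hφ : φ ∈ charts p n M := IsManifold.chart_mem_maximalAtlas g
  have hV : IsOpen (U ∩ φ.source) := hU.inter φ.open_source
  have h1 := measure_mono_null (inter_subset_left (t := φ.source)) h
  rw [hμ φ hφ _ hV.measurableSet inter_subset_right] at h1
  have hVo : IsOpen (φ '' (U ∩ φ.source)) := φ.isOpen_image_of_subset_source hV inter_subset_right
  have hsub : φ '' (U ∩ φ.source) ⊆ φ.target := by
    rintro _ ⟨x, hx, rfl⟩
    exact φ.map_source hx.2
  rw [setLIntegral_eq_zero_iff' hVo.measurableSet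
    ((hΩ φ hφ).continuousOn.enorm.mono hsub |>.aemeasurable hVo.measurableSet)] at h1
  have hne : φ '' (U ∩ φ.source) ⊆ {x | ¬ (x ∈ φ '' (U ∩ φ.source) → ‖coeff Ω φ x‖ₑ = 0)} := by
    rintro _ ⟨x, hx, rfl⟩ hc
    have hc := hc ⟨x, hx, rfl⟩
    rw [enorm_eq_zero] at hc
    have := topForm_eq_coeff_smul Ω hφ hx.2
    rw [hc, zero_smul] at this
    exact h0 x this
  exact hVo.measure_ne_zero (haarPadic p n) ⟨φ g, g, ⟨hg, mem_chart_source _ g⟩, rfl⟩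
    (measure_mono_null hne h1)

/-- The coefficient of an analytic form is bounded on a compact ball in the range of a chart. -/
theorem isLocallyFiniteMeasure_of_hasFormDensity {Ω : TopForm p n M}
    (hΩ : IsAnalyticForm Ω) {μ : Measure M} (hμ : HasFormDensity Ω μ) :
    IsLocallyFiniteMeasure μ := by
  refine ⟨fun g => ?_⟩
  set φ := chartAt (Fin n → ℚ_[p]) g
  have hφ : φ ∈ charts p n M := IsManifold.chart_mem_maximalAtlas g
  have hg : g ∈ φ.source := mem_chart_source _ g
  obtain ⟨r, hr, h⟩ := nhds_basis_closedBall.mem_iff.1 (φ.open_target.mem_nhds (φ.map_source hg))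
  have himg : φ '' (φ.symm '' closedBall (φ g) r) = closedBall (φ g) r := by
    rw [image_image]
    exact (image_congr fun x hx => φ.right_inv (h hx)).trans (image_id' _)
  have hsub : φ.symm '' closedBall (φ g) r ⊆ φ.source :=
    image_subset_iff.2 fun x hx => φ.map_target (h hx)
  refine ⟨φ.symm '' closedBall (φ g) r, ?_, ?_⟩
  · have := φ.symm.image_mem_nhds (φ.map_source hg) (closedBall_mem_nhds (φ g) hr)
    rwa [φ.left_inv hg] at this
  · rw [hμ φ hφ _ (measurableSet_image_openPartialHomeomorph φ.symm
      isClosed_closedBall.measurableSet h) hsub, himg]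
    have hK := isCompact_closedBall (φ g) r
    obtain ⟨C, hC⟩ := hK.exists_bound_of_continuousOn ((hΩ φ hφ).continuousOn.mono h)
    refine setLIntegral_lt_top_of_le_nnreal hK.measure_lt_top.ne ⟨C.toNNReal, fun x hx => ?_⟩
    rw [← ofReal_norm]
    exact ENNReal.ofReal_le_ofReal (hC x hx)

variable [SecondCountableTopology M]

/-- The measures on the chart domains can be glued: cut the manifold into countably many disjoint
pieces, each inside the domain of a chart. -/
theorem exists_measure_eq_chartMeasure [Nonempty M] {Ω : TopForm p n M} (hΩ : IsAnalyticForm Ω) :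
    ∃ ν : Measure M, ∀ φ ∈ charts p n M, ∀ s ⊆ φ.source, MeasurableSet s →
      ν s = chartMeasure Ω φ s := by
  obtain ⟨S, hS, hcov⟩ := TopologicalSpace.countable_cover_nhds
    fun g : M => (chartAt (Fin n → ℚ_[p]) g).open_source.mem_nhds (mem_chart_source _ g)
  have hSne : S.Nonempty := by
    obtain ⟨g⟩ := ‹Nonempty M›
    have hg : g ∈ ⋃ x ∈ S, (chartAt (Fin n → ℚ_[p]) x).source := hcov ▸ mem_univ g
    obtain ⟨x, hx, -⟩ := mem_iUnion₂.1 hg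
    exact ⟨x, hx⟩
  obtain ⟨u, rfl⟩ := hS.exists_eq_range hSne
  rw [biUnion_range] at hcov
  set c := fun i => chartAt (Fin n → ℚ_[p]) (u i)
  set D := disjointed fun i => (c i).source
  have hDm : ∀ i, MeasurableSet (D i) :=
    MeasurableSet.disjointed fun i => (c i).open_source.measurableSet
  have hDc : ∀ i, D i ⊆ (c i).source := disjointed_subset _
  refine ⟨Measure.sum fun i => (chartMeasure Ω (c i)).restrict (D i), fun φ hφ s hsφ hs => ?_⟩
  have h1 : chartMeasure Ω φ = Measure.sum fun i => (chartMeasure Ω φ).restrict (D i) := by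
    rw [← Measure.restrict_iUnion (disjoint_disjointed _) hDm, iUnion_disjointed, hcov,
      Measure.restrict_univ]
  rw [h1, Measure.sum_apply _ hs, Measure.sum_apply _ hs]
  refine tsum_congr fun i => ?_
  rw [Measure.restrict_apply hs, Measure.restrict_apply hs]
  exact chartMeasure_eq_chartMeasure hΩ (IsManifold.chart_mem_maximalAtlas _) hφ
    (hs.inter (hDm i)) (inter_subset_right.trans (hDc i)) (inter_subset_left.trans hsφ)

/-- The glued measure dominates all chart measures, hence also their supremum `inducedMeasure Ω`;
so on the domain of a chart the latter lies between the chart measure and itself. -/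
theorem hasFormDensity_inducedMeasure [Nonempty M] {Ω : TopForm p n M} (hΩ : IsAnalyticForm Ω) :
    HasFormDensity Ω (inducedMeasure Ω) := by
  obtain ⟨ν, hν⟩ := exists_measure_eq_chartMeasure hΩ
  have hle : inducedMeasure Ω ≤ ν := by
    refine iSup₂_le fun φ hφ => Measure.le_iff.2 fun s hs => ?_
    rw [chartMeasure_apply _ _ hs]
    have h := chartMeasure_apply Ω φ (hs.inter φ.open_source.measurableSet)
    rw [inter_assoc, inter_self, ← hν φ hφ _ inter_subset_right
      (hs.inter φ.open_source.measurableSet)] at h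
    rw [← h]
    exact measure_mono inter_subset_left
  intro φ hφ s hs hsφ
  have h := chartMeasure_apply Ω φ hs
  rw [inter_eq_left.2 hsφ] at h
  rw [← h]
  refine le_antisymm ?_ ?_
  · rw [← hν φ hφ s hsφ hs]
    exact hle s
  · exact (le_iSup₂ (f := fun φ (_ : φ ∈ charts p n M) => chartMeasure Ω φ) φ hφ : _) s

theorem HasFormDensity.eq {Ω : TopForm p n M} {μ ν : Measure M} (hμ : HasFormDensity Ω μ)
    (hν : HasFormDensity Ω ν) : μ = ν :=
  eq_of_forall_open_eq fun g => ⟨_, (chartAt (Fin n → ℚ_[p]) g).open_source,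
    mem_chart_source _ g, fun s hs hsm =>
    (hμ _ (IsManifold.chart_mem_maximalAtlas g) s hsm hs).trans
      (hν _ (IsManifold.chart_mem_maximalAtlas g) s hsm hs).symm⟩

theorem inducedMeasure_const_smul [Nonempty M] {Ω : TopForm p n M} (hΩ : IsAnalyticForm Ω)
    (c : ℚ_[p]) : inducedMeasure (c • Ω) = ‖c‖₊ • inducedMeasure Ω := by
  have hcΩ : IsAnalyticForm (c • Ω) := fun φ hφ => analyticOnNhd_const.mul (hΩ φ hφ)
  refine (hasFormDensity_inducedMeasure hcΩ).eq fun φ hφ s hs hsφ => ?_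
  rw [Measure.smul_apply, hasFormDensity_inducedMeasure hΩ φ hφ s hs hsφ]
  simp only [coeff_const_smul, enorm_mul]
  rw [lintegral_const_mul' _ _ enorm_ne_top]
  rfl

end FormMeasure

/-! ### Left-invariant forms -/

section InvariantForms

variable {p : ℕ} [Fact p.Prime] {n : ℕ}

local notation "𝕀" => 𝓘(ℚ_[p], Fin n → ℚ_[p])

variable {G : Type*} [Group G] [TopologicalSpace G] [ChartedSpace (Fin n → ℚ_[p]) G]

/-- Moves the base point of a derivative along an equality, using that all tangent spaces are the
model space by definition. -/
theorem hasMFDerivAt_congr_point {M N : Type*} [TopologicalSpace M]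
    [ChartedSpace (Fin n → ℚ_[p]) M] [TopologicalSpace N] [ChartedSpace (Fin n → ℚ_[p]) N]
    {f : M → N} {x y : M} (h : x = y) {f' : (Fin n → ℚ_[p]) →L[ℚ_[p]] (Fin n → ℚ_[p])}
    (hf : HasMFDerivAt 𝕀 𝕀 f x f') : HasMFDerivAt 𝕀 𝕀 f y f' := by
  subst h; exact hf

variable [ContMDiffMul 𝓘(ℚ_[p], Fin n → ℚ_[p]) ω G]

theorem mdifferentiable_mul_left_padic (h : G) : MDifferentiable 𝕀 𝕀 (fun g : G => h * g) :=
  (contMDiff_mul_left (n := ω)).mdifferentiable (by simp)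

variable (b : Module.Basis (Fin n) ℚ_[p] (TangentSpace 𝓘(ℚ_[p], Fin n → ℚ_[p]) (1 : G)))

/-- The frame `invFrame b` consists of left-invariant vector fields. -/
theorem mfderiv_mul_left_invFrame (h g : G) (j : Fin n) :
    mfderiv 𝕀 𝕀 (fun x : G => h * x) g (invFrame b g j) = invFrame b (h * g) j := by
  have h1 : HasMFDerivAt 𝕀 𝕀 (fun x : G => h * x) (g * 1)
      (mfderiv 𝕀 𝕀 (fun x : G => h * x) g) :=
    hasMFDerivAt_congr_point (mul_one g).symm (mdifferentiable_mul_left_padic h g).hasMFDerivAt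
  have h2 := h1.comp (1 : G) (mdifferentiable_mul_left_padic g 1).hasMFDerivAt
  have e : (fun x : G => h * x) ∘ (fun x : G => g * x) = fun x : G => h * g * x :=
    funext fun x => (mul_assoc h g x).symm
  rw [e] at h2
  exact (congrArg (fun A : (Fin n → ℚ_[p]) →L[ℚ_[p]] (Fin n → ℚ_[p]) => A (b j)) h2.mfderiv).symm

theorem invForm_eq_det (g : G) : invForm b g = (invFrame b g).det :=
  wedge_coord _

theorem invForm_apply_invFrame (g : G) : invForm b g (invFrame b g) = 1 := by
  rw [invForm_eq_det, Module.Basis.det_self]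

theorem invForm_ne_zero (g : G) : invForm b g ≠ 0 := by
  intro h
  have := invForm_apply_invFrame b g
  rw [h] at this
  exact zero_ne_one this

theorem pullback_mul_left_apply_invFrame (Ω : TopForm p n G) (h g : G) :
    pullback (fun x : G => h * x) Ω g (invFrame b g) = Ω (h * g) (invFrame b (h * g)) := by
  refine congrArg (Ω (h * g)) ?_
  ext j : 1
  exact mfderiv_mul_left_invFrame b h g j

theorem isLeftInvariantForm_invForm : IsLeftInvariantForm (invForm b) := by
  intro h
  funext g
  rw [AlternatingMap.eq_smul_basis_det (invFrame b g) (pullback (fun x : G => h * x) _ g),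
    pullback_mul_left_apply_invFrame, invForm_apply_invFrame, one_smul, invForm_eq_det]

/-- A left-invariant form is determined by its value on a basis of the tangent space at the
identity. -/
theorem IsLeftInvariantForm.eq_smul_invForm {Ω : TopForm p n G} (hΩ : IsLeftInvariantForm Ω) :
    Ω = Ω 1 (invFrame b 1) • invForm b := by
  funext g
  have h1 : Ω g (invFrame b g) = Ω 1 (invFrame b 1) := by
    have h2 := pullback_mul_left_apply_invFrame b Ω g 1
    rw [hΩ g] at h2
    rw [h2]
    exact congrArg (fun x : G => Ω x (invFrame b x)) (mul_one g).symm
  rw [AlternatingMap.eq_smul_basis_det (invFrame b g) (Ω g), h1, ← invForm_eq_det]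
  rfl

/-! ### The Jacobian of the multiplication -/

variable {φ₀ φ : OpenPartialHomeomorph G (Fin n → ℚ_[p])}

theorem hasFDerivAt_zeta (hφ₀ : φ₀ ∈ charts p n G) (he : (1 : G) ∈ φ₀.source)
    (hφ : φ ∈ charts p n G) {g : G} (hg : g ∈ φ.source) :
    HasFDerivAt (𝕜 := ℚ_[p]) (zeta φ₀ φ g)
      ((mfderiv 𝕀 𝕀 φ g) ∘L ((mfderiv 𝕀 𝕀 (fun x : G => g * x) 1) ∘L
        (mfderiv 𝕀 𝕀 φ₀.symm (φ₀ 1))) : (Fin n → ℚ_[p]) →L[ℚ_[p]] (Fin n → ℚ_[p])) (φ₀ 1) := by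
  have e0 : 1 = φ₀.symm (φ₀ 1) := (φ₀.left_inv he).symm
  have e1 : g = g * φ₀.symm (φ₀ 1) := by rw [← e0, mul_one]
  have h0 : HasMFDerivAt 𝕀 𝕀 φ₀.symm (φ₀ 1) (mfderiv 𝕀 𝕀 φ₀.symm (φ₀ 1)) :=
    ((mdifferentiable_of_mem_charts hφ₀).mdifferentiableAt_symm (φ₀.map_source he)).hasMFDerivAt
  have h1 : HasMFDerivAt 𝕀 𝕀 (fun x : G => g * x) (φ₀.symm (φ₀ 1))
      (mfderiv 𝕀 𝕀 (fun x : G => g * x) 1) :=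
    hasMFDerivAt_congr_point e0 (mdifferentiable_mul_left_padic g 1).hasMFDerivAt
  have h2 : HasMFDerivAt 𝕀 𝕀 φ (g * φ₀.symm (φ₀ 1)) (mfderiv 𝕀 𝕀 φ g) :=
    hasMFDerivAt_congr_point e1
      ((mdifferentiable_of_mem_charts hφ).mdifferentiableAt hg).hasMFDerivAt
  exact hasMFDerivAt_iff_hasFDerivAt.1 (h2.comp (φ₀ 1) (h1.comp (φ₀ 1) h0))

/-- The Jacobian is the value of `dx₁ ∧ … ∧ dxₙ` on the left-invariant fields that extend the
coordinate vectors of `φ₀` at the identity. -/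
theorem jac_eq_coordForm_invFrame (hφ₀ : φ₀ ∈ charts p n G) (he : (1 : G) ∈ φ₀.source)
    (hφ : φ ∈ charts p n G) {g : G} (hg : g ∈ φ.source) :
    jac φ₀ φ g = coordForm φ g (invFrame (coordBasis hφ₀ he) g) := by
  rw [jac, (hasFDerivAt_zeta hφ₀ he hφ hg).fderiv]
  refine (coordForm_comp φ g ((mfderiv 𝕀 𝕀 (fun x : G => g * x) 1) ∘L
        (mfderiv 𝕀 𝕀 φ₀.symm (φ₀ 1)) :
          (Fin n → ℚ_[p]) →L[ℚ_[p]] (Fin n → ℚ_[p]))).symm.trans (congrArg (coordForm φ g) ?_)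
  ext i : 1
  exact congrArg (mfderiv 𝕀 𝕀 (fun x : G => g * x) 1) (coordBasis_apply hφ₀ he i).symm

theorem jac_ne_zero (hφ₀ : φ₀ ∈ charts p n G) (he : (1 : G) ∈ φ₀.source)
    (hφ : φ ∈ charts p n G) {g : G} (hg : g ∈ φ.source) : jac φ₀ φ g ≠ 0 := by
  rw [jac_eq_coordForm_invFrame hφ₀ he hφ hg, coordForm_eq_det hφ hg]
  exact (Module.Basis.isUnit_det _ _).ne_zero

/-- The invariant form of the coordinate basis of `φ₀` at the identity has the coefficient
`(jac φ₀ φ g)⁻¹` in every chart `φ` around `g`. -/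
theorem invForm_coordBasis (hφ₀ : φ₀ ∈ charts p n G) (he : (1 : G) ∈ φ₀.source)
    (hφ : φ ∈ charts p n G) {g : G} (hg : g ∈ φ.source) :
    invForm (coordBasis hφ₀ he) g = (jac φ₀ φ g)⁻¹ • coordForm φ g := by
  rw [AlternatingMap.eq_smul_basis_det (invFrame (coordBasis hφ₀ he) g) (coordForm φ g),
    ← jac_eq_coordForm_invFrame hφ₀ he hφ hg, smul_smul,
    inv_mul_cancel₀ (jac_ne_zero hφ₀ he hφ hg), one_smul, invForm_eq_det]

theorem jacobianForm_eq_invForm (hφ₀ : φ₀ ∈ charts p n G) (he : (1 : G) ∈ φ₀.source) :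
    jacobianForm φ₀ = invForm (coordBasis hφ₀ he) :=
  funext fun g => (invForm_coordBasis hφ₀ he (IsManifold.chart_mem_maximalAtlas g)
    (mem_chart_source _ g)).symm

theorem coeff_jacobianForm (hφ₀ : φ₀ ∈ charts p n G) (he : (1 : G) ∈ φ₀.source)
    (hφ : φ ∈ charts p n G) {x : Fin n → ℚ_[p]} (hx : x ∈ φ.target) :
    coeff (jacobianForm φ₀) φ x = (jac φ₀ φ (φ.symm x))⁻¹ := by
  refine coeff_smul_coordForm hφ hx ?_
  rw [jacobianForm_eq_invForm hφ₀ he]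
  exact invForm_coordBasis hφ₀ he hφ (φ.map_target hx)

/-! ### Analyticity of the invariant forms -/

variable (φ₀ φ) in
/-- The multiplication of `G`, read in the charts `φ` and `φ₀` for the factors and `φ` for the
product. -/
noncomputable def mulCoord (q : (Fin n → ℚ_[p]) × (Fin n → ℚ_[p])) : Fin n → ℚ_[p] :=
  φ (φ.symm q.1 * φ₀.symm q.2)

theorem analyticAt_mulCoord (hφ₀ : φ₀ ∈ charts p n G) (he : (1 : G) ∈ φ₀.source)
    (hφ : φ ∈ charts p n G) {x : Fin n → ℚ_[p]} (hx : x ∈ φ.target) :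
    AnalyticAt ℚ_[p] (mulCoord φ₀ φ) (x, φ₀ 1) := by
  have h1 : ContMDiffAt 𝓘(ℚ_[p], (Fin n → ℚ_[p]) × (Fin n → ℚ_[p])) 𝕀 ω
      (fun q : (Fin n → ℚ_[p]) × (Fin n → ℚ_[p]) => φ.symm q.1) (x, φ₀ 1) := by
    have hs : ContMDiffAt 𝕀 𝕀 ω φ.symm x := contMDiffAt_symm_of_mem_maximalAtlas hφ hx
    have hf : ContMDiffAt 𝓘(ℚ_[p], (Fin n → ℚ_[p]) × (Fin n → ℚ_[p])) 𝕀 ω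
      (fun q : (Fin n → ℚ_[p]) × (Fin n → ℚ_[p]) => q.1) (x, φ₀ 1) :=
      contMDiffAt_iff_contDiffAt.2 contDiffAt_fst
    exact ContMDiffAt.comp (x, φ₀ 1) hs hf
  have h2 : ContMDiffAt 𝓘(ℚ_[p], (Fin n → ℚ_[p]) × (Fin n → ℚ_[p])) 𝕀 ω
      (fun q : (Fin n → ℚ_[p]) × (Fin n → ℚ_[p]) => φ₀.symm q.2) (x, φ₀ 1) := by
    have hs : ContMDiffAt 𝕀 𝕀 ω φ₀.symm (φ₀ 1) :=
      contMDiffAt_symm_of_mem_maximalAtlas hφ₀ (φ₀.map_source he)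
    have hf : ContMDiffAt 𝓘(ℚ_[p], (Fin n → ℚ_[p]) × (Fin n → ℚ_[p])) 𝕀 ω
      (fun q : (Fin n → ℚ_[p]) × (Fin n → ℚ_[p]) => q.2) (x, φ₀ 1) :=
      contMDiffAt_iff_contDiffAt.2 contDiffAt_snd
    exact ContMDiffAt.comp (x, φ₀ 1) hs hf
  have h3 := h1.mul h2
  have h4 : ContMDiffAt 𝕀 𝕀 ω φ (φ.symm x * φ₀.symm (φ₀ 1)) := by
    rw [φ₀.left_inv he, mul_one]
    exact contMDiffAt_of_mem_maximalAtlas hφ (φ.map_target hx)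
  exact (contMDiffAt_iff_contDiffAt.1 (ContMDiffAt.comp (x, φ₀ 1) h4 h3)).analyticAt

/-- The derivative of `zeta` is a partial derivative of the multiplication, and so depends
analytically on the group element. -/
theorem fderiv_zeta_eq (hφ₀ : φ₀ ∈ charts p n G) (he : (1 : G) ∈ φ₀.source)
    (hφ : φ ∈ charts p n G) {x : Fin n → ℚ_[p]} (hx : x ∈ φ.target) :
    fderiv ℚ_[p] (zeta φ₀ φ (φ.symm x)) (φ₀ 1) =
      (fderiv ℚ_[p] (mulCoord φ₀ φ) (x, φ₀ 1)) ∘L ContinuousLinearMap.inr ℚ_[p] _ _ :=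
  ((analyticAt_mulCoord hφ₀ he hφ hx).differentiableAt.hasFDerivAt.comp (φ₀ 1)
    (hasFDerivAt_prodMk_right x (φ₀ 1))).fderiv

theorem analyticAt_continuousLinearMap_det (A : (Fin n → ℚ_[p]) →L[ℚ_[p]] (Fin n → ℚ_[p])) :
    AnalyticAt ℚ_[p]
      (fun B : (Fin n → ℚ_[p]) →L[ℚ_[p]] (Fin n → ℚ_[p]) => B.det) A := by
  have h : (fun B : (Fin n → ℚ_[p]) →L[ℚ_[p]] (Fin n → ℚ_[p]) => B.det) = fun B =>
      ∑ σ : Equiv.Perm (Fin n), ((Equiv.Perm.sign σ : ℤ) : ℚ_[p]) *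
        ∏ i, ContinuousLinearMap.proj (R := ℚ_[p]) (φ := fun _ : Fin n => ℚ_[p]) (σ i)
          (ContinuousLinearMap.apply ℚ_[p] (Fin n → ℚ_[p])
            (Pi.single i 1 : Fin n → ℚ_[p]) B) := by
    funext B
    rw [ContinuousLinearMap.det, ← LinearMap.det_toMatrix', Matrix.det_apply']
    simp [LinearMap.toMatrix'_apply]
  rw [h]
  refine Finset.analyticAt_fun_sum _ fun σ _ => analyticAt_const.mul
    (Finset.analyticAt_fun_prod _ fun i _ => ?_)
  exact (ContinuousLinearMap.proj (R := ℚ_[p]) (φ := fun _ : Fin n => ℚ_[p]) (σ i) ∘L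
    ContinuousLinearMap.apply ℚ_[p] (Fin n → ℚ_[p])
      (Pi.single i 1 : Fin n → ℚ_[p])).analyticAt A

theorem isAnalyticForm_jacobianForm (hφ₀ : φ₀ ∈ charts p n G) (he : (1 : G) ∈ φ₀.source) :
    IsAnalyticForm (jacobianForm φ₀) := by
  intro φ hφ x hx
  have h1 : AnalyticAt ℚ_[p] (fun y => (fderiv ℚ_[p] (mulCoord φ₀ φ) (y, φ₀ 1)) ∘L
      ContinuousLinearMap.inr ℚ_[p] (Fin n → ℚ_[p]) (Fin n → ℚ_[p])) x := by
    have h2 : AnalyticAt ℚ_[p] (fun y : Fin n → ℚ_[p] => (y, φ₀ 1)) x :=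
      analyticAt_id.prod analyticAt_const
    have h3 : AnalyticAt ℚ_[p] (fun y => fderiv ℚ_[p] (mulCoord φ₀ φ) (y, φ₀ 1)) x :=
      AnalyticAt.fun_comp (f := fun y : Fin n → ℚ_[p] => (y, φ₀ 1))
        (analyticAt_mulCoord hφ₀ he hφ hx).fderiv h2
    exact (((ContinuousLinearMap.compL ℚ_[p] _ _ _).flip
      (ContinuousLinearMap.inr ℚ_[p] (Fin n → ℚ_[p]) (Fin n → ℚ_[p]))).analyticAt _).fun_comp h3
  have h4 := (analyticAt_continuousLinearMap_det _).fun_comp h1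
  have h5 := h4.inv (by
    rw [← fderiv_zeta_eq hφ₀ he hφ hx]
    exact jac_ne_zero hφ₀ he hφ (φ.map_target hx))
  refine h5.congr ?_
  filter_upwards [φ.open_target.mem_nhds hx] with y hy
  rw [coeff_jacobianForm hφ₀ he hφ hy, jac, fderiv_zeta_eq hφ₀ he hφ hy]
  rfl

/-- All invariant forms are multiples of the one given by the Jacobians of a chart. -/
theorem isAnalyticForm_invForm : IsAnalyticForm (invForm b) := by
  have hφ₀ : chartAt (Fin n → ℚ_[p]) (1 : G) ∈ charts p n G := IsManifold.chart_mem_maximalAtlas 1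
  have he := mem_chart_source (Fin n → ℚ_[p]) (1 : G)
  have h := (isLeftInvariantForm_invForm b).eq_smul_invForm (coordBasis hφ₀ he)
  rw [← jacobianForm_eq_invForm hφ₀ he] at h
  rw [h]
  exact fun φ hφ => analyticOnNhd_const.mul (isAnalyticForm_jacobianForm hφ₀ he φ hφ)

end InvariantForms

/-! ### Continuity of the inversion -/
/-- By the implicit function theorem the equation `g * h = 1` has near the identity a solution `h`
that depends continuously on `g`, and left translations carry the continuity of the inversion at
the identity to the whole group. -/
theorem isTopologicalGroup_of_contMDiffMul (p : ℕ) [Fact p.Prime] (n : ℕ) (G : Type*) [Group G]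
    [TopologicalSpace G] [ChartedSpace (Fin n → ℚ_[p]) G]
    [ContMDiffMul 𝓘(ℚ_[p], Fin n → ℚ_[p]) ω G] : IsTopologicalGroup G := by
  have : ContinuousMul G := continuousMul_of_contMDiffMul 𝓘(ℚ_[p], Fin n → ℚ_[p]) ω
  set φ := chartAt (Fin n → ℚ_[p]) (1 : G)
  have hφ : φ ∈ charts p n G := IsManifold.chart_mem_maximalAtlas 1
  have he : 1 ∈ φ.source := mem_chart_source (Fin n → ℚ_[p]) (1 : G)
  have ht := φ.map_source he
  have h1 := (analyticAt_mulCoord hφ he hφ ht).hasStrictFDerivAt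
  have h2 : ((fderiv ℚ_[p] (mulCoord φ φ) (φ 1, φ 1)) ∘L
      ContinuousLinearMap.inr ℚ_[p] (Fin n → ℚ_[p]) (Fin n → ℚ_[p])).IsInvertible := by
    rw [← fderiv_zeta_eq hφ he hφ ht]
    exact ⟨_, ContinuousLinearMap.coe_toContinuousLinearEquivOfDetNeZero _
      (jac_ne_zero hφ he hφ (φ.map_target ht))⟩
  set f := h1.implicitFunctionOfProdDomain h2
  have hf : Filter.Tendsto f (𝓝 (φ 1)) (𝓝 (φ 1)) := h1.tendsto_implicitFunctionOfProdDomain h2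
  have hφ1 : Filter.Tendsto φ (𝓝 1) (𝓝 (φ 1)) := φ.continuousAt he
  have hlim : Filter.Tendsto (fun g => φ.symm (f (φ g))) (𝓝 1) (𝓝 1) := by
    have := (φ.symm.continuousAt ht).tendsto.comp (hf.comp hφ1)
    rwa [φ.left_inv he] at this
  have hinv : ∀ᶠ g in 𝓝 (1 : G), φ.symm (f (φ g)) = g⁻¹ := by
    have hm : ∀ᶠ g in 𝓝 (1 : G), g * φ.symm (f (φ g)) ∈ φ.source := by
      have : Filter.Tendsto (fun g => g * φ.symm (f (φ g))) (𝓝 1) (𝓝 (1 * 1)) :=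
        Filter.tendsto_id.mul hlim
      rw [one_mul] at this
      exact this (φ.open_source.mem_nhds he)
    filter_upwards [hm, φ.open_source.mem_nhds he,
      hφ1.eventually (h1.eventually_apply_implicitFunctionOfProdDomain h2)] with g hg hgs hgf
    simp only [mulCoord] at hgf
    rw [φ.left_inv hgs, φ.left_inv he, mul_one] at hgf
    exact eq_inv_of_mul_eq_one_right (φ.injOn hg he hgf)
  have hcont : Filter.Tendsto (fun g : G => g⁻¹) (𝓝 1) (𝓝 1) := hlim.congr' hinv
  refine { continuous_inv := continuous_iff_continuousAt.2 fun a => ?_ }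
  have h3 : Filter.Tendsto (fun g : G => a⁻¹ * g) (𝓝 a) (𝓝 1) := by
    have : ContinuousAt (fun g : G => a⁻¹ * g) a := (continuous_const_mul a⁻¹).continuousAt
    rwa [ContinuousAt, inv_mul_cancel] at this
  have h4 := (hcont.comp h3).mul_const a⁻¹
  rw [one_mul] at h4
  refine h4.congr fun g => ?_
  simp

/-! ### Haar measures from invariant forms -/

section HaarMeasure

variable {p : ℕ} [Fact p.Prime] {n : ℕ}

variable {G : Type*} [Group G] [TopologicalSpace G]
  [ChartedSpace (Fin n → ℚ_[p]) G] [ContMDiffMul 𝓘(ℚ_[p], Fin n → ℚ_[p]) ω G]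
  [MeasurableSpace G] [BorelSpace G]

theorem hasJacobianDensity_of_hasFormDensity {φ₀ φ : OpenPartialHomeomorph G (Fin n → ℚ_[p])}
    (hφ₀ : φ₀ ∈ charts p n G) (he : (1 : G) ∈ φ₀.source) (hφ : φ ∈ charts p n G)
    {μ : Measure G} (hμ : HasFormDensity (jacobianForm φ₀) μ) : HasJacobianDensity φ₀ φ μ := by
  intro s hs
  have hm := hs.inter φ.open_source.measurableSet
  rw [hμ φ hφ _ hm inter_subset_right]
  refine setLIntegral_congr_fun
    (measurableSet_image_openPartialHomeomorph φ hm inter_subset_right) fun x hx => ?_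
  have hx' : x ∈ φ.target := by
    obtain ⟨g, hg, rfl⟩ := hx
    exact φ.map_source hg.2
  simp only [coeff_jacobianForm hφ₀ he hφ hx', ← ofReal_norm, norm_inv]

variable [SecondCountableTopology G]

/-- By the change of variables formula for a left translation, which preserves the form, a set and
its translate have the same measure. -/
theorem isMulLeftInvariant_of_hasFormDensity {Ω : TopForm p n G} (hΩ : IsAnalyticForm Ω)
    (hinv : IsLeftInvariantForm Ω) {μ : Measure G} (hμ : HasFormDensity Ω μ) :
    μ.IsMulLeftInvariant := by
  have := isTopologicalGroup_of_contMDiffMul p n G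
  refine ⟨fun h => eq_of_forall_open_eq fun g => ?_⟩
  set φ := chartAt (Fin n → ℚ_[p]) (h⁻¹ * g)
  set ψ := chartAt (Fin n → ℚ_[p]) g
  have hφ : φ ∈ charts p n G := IsManifold.chart_mem_maximalAtlas _
  have hψ : ψ ∈ charts p n G := IsManifold.chart_mem_maximalAtlas _
  refine ⟨ψ.source ∩ (fun x => h⁻¹ * x) ⁻¹' φ.source,
    ψ.open_source.inter (φ.open_source.preimage (continuous_const_mul _)),
    ⟨mem_chart_source _ g, mem_chart_source _ (h⁻¹ * g)⟩, fun s hs hsm => ?_⟩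
  have hm : Measurable fun x : G => h * x := (continuous_const_mul h).measurable
  have himg : Homeomorph.mulLeft h '' ((fun x => h * x) ⁻¹' s) = s :=
    image_preimage_eq s (Homeomorph.mulLeft h).surjective
  have hsφ : (fun x => h * x) ⁻¹' s ⊆ φ.source := fun x hx => by
    have := (hs hx).2
    rwa [mem_preimage, inv_mul_cancel_left] at this
  have hsψ : s ⊆ ψ.source := hs.trans inter_subset_left
  have key := setLIntegral_enorm_coeff_image hΩ (Homeomorph.mulLeft h) contMDiff_mul_left
    contMDiff_mul_left (hinv h) hφ hψ (hm hsm) hsφ (himg.symm ▸ hsψ)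
  rw [himg] at key
  rw [Measure.map_apply hm hsm, hμ φ hφ _ (hm hsm) hsφ, hμ ψ hψ s hsm hsψ, key]

theorem isHaarMeasure_inducedMeasure {Ω : TopForm p n G} (hΩ : IsAnalyticForm Ω)
    (hinv : IsLeftInvariantForm Ω) (h0 : ∀ g, Ω g ≠ 0) : (inducedMeasure Ω).IsHaarMeasure := by
  have hμ := hasFormDensity_inducedMeasure hΩ
  have := isLocallyFiniteMeasure_of_hasFormDensity hΩ hμ
  have := isOpenPosMeasure_of_hasFormDensity hΩ h0 hμ
  have := isMulLeftInvariant_of_hasFormDensity hΩ hinv hμ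
  exact { }

/-- The Jacobian formula on a family of charts that covers the group determines the measure. -/
theorem eq_of_hasJacobianDensity {φ₀ : OpenPartialHomeomorph G (Fin n → ℚ_[p])}
    (hφ₀ : φ₀ ∈ charts p n G) (he : (1 : G) ∈ φ₀.source)
    {μ ν : Measure G} (hμ : ∀ g : G, ∃ φ ∈ charts p n G, g ∈ φ.source ∧ HasJacobianDensity φ₀ φ μ)
    (hν : HasFormDensity (jacobianForm φ₀) ν) : μ = ν := by
  refine eq_of_forall_open_eq fun g => ?_
  obtain ⟨φ, hφ, hg, hd⟩ := hμ g
  refine ⟨φ.source, φ.open_source, hg, fun s hs hsm => ?_⟩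
  have h1 := hd s hsm
  rw [← hasJacobianDensity_of_hasFormDensity hφ₀ he hφ hν s hsm, inter_eq_left.2 hs] at h1
  exact h1

end HaarMeasure

end PadicLie

theorem mainTheorem2 (p : ℕ) [Fact p.Prime] (n : ℕ) {G : Type*} [Group G] [TopologicalSpace G]
    [T2Space G] [SecondCountableTopology G] [ChartedSpace (Fin n → ℚ_[p]) G]
    [ContMDiffMul 𝓘(ℚ_[p], Fin n → ℚ_[p]) ω G] [MeasurableSpace G] [BorelSpace G]
    (φ₀ : OpenPartialHomeomorph G (Fin n → ℚ_[p])) (hφ₀ : φ₀ ∈ PadicLie.charts p n G)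
    (he : (1 : G) ∈ φ₀.source)
    (b : Module.Basis (Fin n) ℚ_[p] (TangentSpace 𝓘(ℚ_[p], Fin n → ℚ_[p]) (1 : G))) :
    -- the Jacobians exist and do not vanish
    (∀ φ ∈ PadicLie.charts p n G, ∀ g ∈ φ.source,
      DifferentiableAt ℚ_[p] (PadicLie.zeta φ₀ φ g) (φ₀ 1) ∧ PadicLie.jac φ₀ φ g ≠ 0) ∧
    -- the local expressions define one analytic form, whatever chart is used
    (∀ φ ∈ PadicLie.charts p n G, ∀ g ∈ φ.source,
      PadicLie.jacobianForm φ₀ g = (PadicLie.jac φ₀ φ g)⁻¹ • PadicLie.coordForm φ g) ∧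
    PadicLie.IsAnalyticForm (PadicLie.jacobianForm φ₀) ∧
    -- this form is left-invariant
    PadicLie.IsLeftInvariantForm (PadicLie.jacobianForm φ₀) ∧
    -- the invariant form is analytic, nowhere zero, left-invariant and essentially unique
    PadicLie.IsAnalyticForm (PadicLie.invForm b) ∧
    (∀ g, PadicLie.invForm b g ≠ 0) ∧
    PadicLie.IsLeftInvariantForm (PadicLie.invForm b) ∧
    (∀ Ω : PadicLie.TopForm p n G, PadicLie.IsLeftInvariantForm Ω →
      ∃ c : ℚ_[p], Ω = c • PadicLie.invForm b) ∧
    -- both forms induce measures by the integral formula in charts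
    PadicLie.HasFormDensity (PadicLie.jacobianForm φ₀)
      (PadicLie.inducedMeasure (PadicLie.jacobianForm φ₀)) ∧
    PadicLie.HasFormDensity (PadicLie.invForm b)
      (PadicLie.inducedMeasure (PadicLie.invForm b)) ∧
    -- the two forms agree up to a constant, and so do their measures
    (∃ c : ℚ_[p], c ≠ 0 ∧ PadicLie.jacobianForm φ₀ = c • PadicLie.invForm b ∧
      PadicLie.inducedMeasure (PadicLie.jacobianForm φ₀) =
        ‖c‖₊ • PadicLie.inducedMeasure (PadicLie.invForm b)) ∧
    -- the measure of the first form is the left Haar measure given by the Jacobian formula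
    (PadicLie.inducedMeasure (PadicLie.jacobianForm φ₀)).IsHaarMeasure ∧
    (∀ φ ∈ PadicLie.charts p n G, PadicLie.HasJacobianDensity φ₀ φ
      (PadicLie.inducedMeasure (PadicLie.jacobianForm φ₀))) ∧
    (∀ μ : Measure G,
      (∀ g : G, ∃ φ ∈ PadicLie.charts p n G, g ∈ φ.source ∧ PadicLie.HasJacobianDensity φ₀ φ μ) →
      μ = PadicLie.inducedMeasure (PadicLie.jacobianForm φ₀)) ∧
    -- the measure of the invariant form is a left Haar measure, hence the one up to a constant
    (PadicLie.inducedMeasure (PadicLie.invForm b)).IsHaarMeasure ∧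
    (∀ μ : Measure G, μ.IsHaarMeasure →
      ∃ c : ℝ≥0, 0 < c ∧ μ = c • PadicLie.inducedMeasure (PadicLie.invForm b)) := by
  open PadicLie in
  have hJ := isAnalyticForm_jacobianForm hφ₀ he
  have hb := isAnalyticForm_invForm b
  have hJb := jacobianForm_eq_invForm hφ₀ he
  have hJinv : IsLeftInvariantForm (jacobianForm φ₀) := by
    rw [hJb]; exact isLeftInvariantForm_invForm _
  have hJ0 : ∀ g, jacobianForm φ₀ g ≠ 0 := by
    rw [hJb]; exact invForm_ne_zero _
  have hbinv := isLeftInvariantForm_invForm b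
  have hJd := hasFormDensity_inducedMeasure hJ
  have hbH := isHaarMeasure_inducedMeasure hb hbinv (invForm_ne_zero b)
  have hc := hJinv.eq_smul_invForm b
  -- the uniqueness of the Haar measure needs a locally compact topological group
  have := isTopologicalGroup_of_contMDiffMul p n G
  have := ChartedSpace.locallyCompactSpace (Fin n → ℚ_[p]) G
  refine ⟨fun φ hφ g hg => ⟨(hasFDerivAt_zeta hφ₀ he hφ hg).differentiableAt,
      jac_ne_zero hφ₀ he hφ hg⟩,
    fun φ hφ g hg => by rw [hJb]; exact invForm_coordBasis hφ₀ he hφ hg,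
    hJ, hJinv, hb, invForm_ne_zero b, hbinv, fun Ω hΩ => ⟨_, hΩ.eq_smul_invForm b⟩, hJd,
    hasFormDensity_inducedMeasure hb, ⟨_, fun h0 => hJ0 1 ?_, hc, ?_⟩,
    isHaarMeasure_inducedMeasure hJ hJinv hJ0,
    fun φ hφ => hasJacobianDensity_of_hasFormDensity hφ₀ he hφ hJd,
    fun μ hμ => eq_of_hasJacobianDensity hφ₀ he hμ hJd, hbH,
    fun μ hμ => ⟨_, Measure.haarScalarFactor_pos_of_isHaarMeasure μ _,
      Measure.isMulLeftInvariant_eq_smul μ _⟩⟩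
  · rw [hc, h0, zero_smul]
    rfl
  · rw [← inducedMeasure_const_smul hb, ← hc]
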